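/- Let $\mathbb{R}^n$ carry a norm $\|\cdot\|$ and let $C\subset\mathbb{R}^n$ be a cone of rank $k\ge 1$: $C$ is closed, $lv\in C$ for all $v\in C$ and $l\in\mathbb{R}$, and $k$ is the maximal dimension of a linear subspace contained in $C$. Assume that $C$ is $k$-solid, i.e. there is a $k$-dimensional subspace $W$ with $W\setminus\{0\}\subset \operatorname{Int}C$. Let $\Phi_t$, $t\in\mathbb{R}$, be a flow on $\mathbb{R}^n$ such that (a) for some $\alpha\in(0,1]$ the map $(t,x)\mapsto\Phi_t(x)$ is $C^1$ on $\mathbb{R}\times\mathbb{R}^n$ with locally $\alpha$-Hölder derivative; (b) $\Phi_t$ is strongly monotone with respect to $C$: if $x-y\in C$, then $\Phi_t(x)-\Phi_t(y)\in C$ for all $t\ge0$, and, if moreover $x\neq y$, then $\Phi_t(x)-\Phi_t(y)\in\operatorname{Int}C$ for all $t>0$; (c) $D_x\Phi_t(C\setminus\{0\})\subset\operatorname{Int}C$ for all $x\in\mathbb{R}^n$ and $t>0$. Write $O(x)=\{\Phi_t(x):t\ge0\}$ and $\omega(x)=\bigcap_{s\ge0}\overline{\{\Phi_t(x):t\ge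 s\}}$. A point $x$ is an equilibrium if $O(x)=\{x\}$. Let $Q$ be the set of points whose orbit is pseudo-ordered, i.e. the points $x$, not equilibria, for which there are $t_1,t_2\ge0$ with $\Phi_{t_1}(x)\ne\Phi_{t_2}(x)$ and $\Phi_{t_1}(x)-\Phi_{t_2}(x)\in C$. Let $K$ be a compact invariant set. A $k$-exponential separation along $K$ associated with $C$ is a pair of families $E=(E_y)_{y\in K}$, $F=(F_y)_{y\in K}$ of linear subspaces of dimensions $k$ and $n-k$, depending continuously on $y$ in the gap metric (the Hausdorff distance of unit spheres), such that for all $y\in K$: $\mathbb{R}^n=E_y\oplus F_y$; $D_y\Phi_tE_y=E_{\Phi_t(y)}$ and $D_y\Phi_tF_y\subset F_{\Phi_t(y)}$ for $t>0$; $E_y\subset\operatorname{Int}C\cup\{0\}$ and $F_y\cap C=\{0\}$; and, with constants $M>0$ and $0<\gamma<1$ independent of $y$, $\|D_y\Phi_tw\|\le M\gamma^t\|D_y\Phi_tv\|$ for all unit vectors $w\in F_y$, $v\in E_y$ and all $t\ge0$. Given such a separation, the $k$-Lyapunov exponent of $z\in K$ is $$\lambda_{kz}=\limsup_{t\to+\infty}\frac{\log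 m(D_z\Phi_t|_{E_z})}{t},\qquad m(D_z\Phi_t|_{E_z})=\inf_{v\in E_z,\ \|v\|=1}\|D_z\Phi_tv\|,$$ and $z$ is a regular point if this upper limit is a limit. **Theorem.** Let $x\in\mathbb{R}^n$ be a point whose orbit $O(x)$ is bounded. Then a $k$-exponential separation along $\omega(x)$ associated with $C$ exists. Moreover, for any such separation, if $z\in\omega(x)$ is a regular point with $\lambda_{kz}\le0$, then either $x\in Q$, or $\omega(x)=\{z\}$ and $z$ is an equilibrium. -/

import Mathlib

open Set Filter Topology
open scoped NNReal

namespace KCone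

section Cone

variable {V : Type*} [NormedAddCommGroup V] [NormedSpace ℝ V]

/-- A cone of rank `k`, `k ≥ 1`: a closed set, invariant under all real scalings, for which `k` is
the maximal dimension of a linear subspace that it contains. -/
structure IsKCone (k : ℕ) (C : Set V) : Prop where
  one_le : 1 ≤ k
  isClosed : IsClosed C
  smul_mem : ∀ v ∈ C, ∀ l : ℝ, l • v ∈ C
  rank : IsGreatest {d : ℕ | ∃ W : Submodule ℝ V, (W : Set V) ⊆ C ∧ Module.finrank ℝ W = d} k

/-- `C` is `k`-solid: some `k`-dimensional subspace `W` satisfies `W \ {0} ⊆ Int C`. -/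
def IsKSolid (k : ℕ) (C : Set V) : Prop :=
  ∃ W : Submodule ℝ V, Module.finrank ℝ W = k ∧ (W : Set V) \ {0} ⊆ interior C

/-- `x` and `y` are ordered. -/
def Ordered (C : Set V) (x y : V) : Prop := x - y ∈ C

/-- `x` and `y` are strongly ordered. -/
def StronglyOrdered (C : Set V) (x y : V) : Prop := x - y ∈ interior C

/-- The gap metric on subspaces: the Hausdorff distance of their unit spheres. -/
noncomputable def gapDist (L₁ L₂ : Submodule ℝ V) : ℝ :=
  Metric.hausdorffDist ((L₁ : Set V) ∩ Metric.sphere 0 1) ((L₂ : Set V) ∩ Metric.sphere 0 1)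

/-- `K × (Y x)` is a `d`-dimensional continuous vector bundle over `K`: the fibres over `K` are
`d`-dimensional, and depend continuously on the base point in the gap metric. -/
structure IsContinuousBundle (K : Set V) (d : ℕ) (Y : V → Submodule ℝ V) : Prop where
  finrank_eq : ∀ x ∈ K, Module.finrank ℝ (Y x) = d
  continuous : ∀ x ∈ K, Tendsto (fun y => gapDist (Y y) (Y x)) (𝓝[K] x) (𝓝 0)

/-- The infimum norm `inf {‖A v‖ : v ∈ L, ‖v‖ = 1}` of `A` restricted to `L`. -/
noncomputable def infNorm (A : V →L[ℝ] V) (L : Submodule ℝ V) : ℝ :=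
  sInf ((fun v => ‖A v‖) '' ((L : Set V) ∩ Metric.sphere 0 1))

end Cone

section Flow

variable {V : Type*} [NormedAddCommGroup V] [NormedSpace ℝ V]

/-- The derivative `D_x Φ_t` of the time-`t` map at `x`. -/
noncomputable def flowDeriv (Φ : Flow ℝ V) (t : ℝ) (x : V) : V →L[ℝ] V :=
  fderiv ℝ (Φ t) x

/-- `Φ` is `C^{1,α}`: the map `(t, x) ↦ Φ_t x` is `C^1` on `ℝ × V`, and its derivative is locally
`α`-Hölder continuous. -/
def IsC1Holder (α : ℝ≥0) (Φ : Flow ℝ V) : Prop :=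
  ContDiff ℝ 1 (fun p : ℝ × V => Φ p.1 p.2) ∧
    ∀ p : ℝ × V, ∃ U ∈ 𝓝 p, ∃ L : ℝ≥0,
      HolderOnWith L α (fderiv ℝ (fun q : ℝ × V => Φ q.1 q.2)) U

/-- `Φ` is monotone with respect to `C`. -/
def IsMonotone (C : Set V) (Φ : Flow ℝ V) : Prop :=
  ∀ x y : V, Ordered C x y → ∀ t : ℝ, 0 ≤ t → Ordered C (Φ t x) (Φ t y)

/-- `Φ` is strongly monotone with respect to `C`. -/
def IsStronglyMonotone (C : Set V) (Φ : Flow ℝ V) : Prop :=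
  IsMonotone C Φ ∧
    ∀ x y : V, x ≠ y → Ordered C x y → ∀ t : ℝ, 0 < t → StronglyOrdered C (Φ t x) (Φ t y)

/-- The standing assumptions on the flow: `C` is a `k`-solid cone of rank `k`, the flow is
`C^{1,α}` for some `α ∈ (0, 1]`, strongly monotone with respect to `C`, and
`D_x Φ_t (C \ {0}) ⊆ Int C` for all `x` and all `t > 0`. -/
structure FWW (k : ℕ) (C : Set V) (Φ : Flow ℝ V) : Prop where
  isKCone : IsKCone k C
  isKSolid : IsKSolid k C
  smooth : ∃ α : ℝ≥0, 0 < α ∧ α ≤ 1 ∧ IsC1Holder α Φ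
  stronglyMonotone : IsStronglyMonotone C Φ
  deriv_mapsTo : ∀ (t : ℝ) (x : V), 0 < t → MapsTo (flowDeriv Φ t x) (C \ {0}) (interior C)

/-- `x` is an equilibrium: its orbit `{Φ_t x : t ≥ 0}` is `{x}`. -/
def IsEquilibrium (Φ : Flow ℝ V) (x : V) : Prop := Φ.forwardOrbit x = {x}

/-- The set `Q` of points with a pseudo-ordered orbit: the orbit is nontrivial, and contains two
distinct points that are ordered. -/
def pseudoOrderedSet (C : Set V) (Φ : Flow ℝ V) : Set V :=
  {x | ¬ IsEquilibrium Φ x ∧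
    ∃ t₁ t₂ : ℝ, 0 ≤ t₁ ∧ 0 ≤ t₂ ∧ Φ t₁ x ≠ Φ t₂ x ∧ Ordered C (Φ t₁ x) (Φ t₂ x)}

/-- The omega-limit set of the point `x`. -/
def omegaSet (Φ : Flow ℝ V) (x : V) : Set V := omegaLimit atTop Φ {x}

/-- `E ⊕ F` is a `k`-exponential separation of `(Φ, DΦ)` along the compact invariant set `K`,
associated with `C`. -/
structure IsExpSeparation (k : ℕ) (C : Set V) (Φ : Flow ℝ V) (K : Set V)
    (E F : V → Submodule ℝ V) : Prop where
  bundle_E : IsContinuousBundle K k E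
  bundle_F : IsContinuousBundle K (Module.finrank ℝ V - k) F
  isCompl : ∀ x ∈ K, IsCompl (E x) (F x)
  map_E : ∀ x ∈ K, ∀ t : ℝ, 0 < t →
    (E x).map (flowDeriv Φ t x : V →ₗ[ℝ] V) = E (Φ t x)
  map_F : ∀ x ∈ K, ∀ t : ℝ, 0 < t →
    (F x).map (flowDeriv Φ t x : V →ₗ[ℝ] V) ≤ F (Φ t x)
  separation : ∃ M γ : ℝ, 0 < M ∧ 0 < γ ∧ γ < 1 ∧
    ∀ x ∈ K, ∀ w ∈ F x, ‖w‖ = 1 → ∀ v ∈ E x, ‖v‖ = 1 → ∀ t : ℝ, 0 ≤ t →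
      ‖flowDeriv Φ t x w‖ ≤ M * γ ^ t * ‖flowDeriv Φ t x v‖
  E_subset : ∀ x ∈ K, (E x : Set V) ⊆ interior C ∪ {0}
  F_inter : ∀ x ∈ K, (F x : Set V) ∩ C = {0}

/-- The quotient `log m(D_x Φ_t | E_x) / t`, as an extended real. -/
noncomputable def lyapunovQuotient (Φ : Flow ℝ V) (E : V → Submodule ℝ V) (x : V) (t : ℝ) :
    EReal :=
  ((Real.log (infNorm (flowDeriv Φ t x) (E x)) / t : ℝ) : EReal)

/-- The `k`-Lyapunov exponent of `x` (with respect to the `k`-dimensional bundle `E`), as an upper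
limit of extended reals. -/
noncomputable def lyapunovExponent (Φ : Flow ℝ V) (E : V → Submodule ℝ V) (x : V) : EReal :=
  limsup (lyapunovQuotient Φ E x) atTop

/-- `x` is a regular point: the upper limit that defines its `k`-Lyapunov exponent is a limit. -/
def IsRegularPoint (Φ : Flow ℝ V) (E : V → Submodule ℝ V) (x : V) : Prop :=
  Tendsto (lyapunovQuotient Φ E x) atTop (𝓝 (lyapunovExponent Φ E x))

end Flow

end KCone

/-!
Call a vector over `y` dominant if its whole orbit under the linearised flow stays in `C`, and
dominated if its forward orbit stays in the complementary cone. Compactness turns the strict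
inclusion `D_y Φ_1 (C \ {0}) ⊆ Int C` into a uniform margin: images under `D_y Φ_1` stay in `Int C`
under perturbations proportional to their norm. If `u` and `v` are dominant, the margin makes
`{r | u + r v dominant}` clopen, hence all of `ℝ`, so the dominant vectors form a subspace, and
likewise the dominated ones. The margin also allows the dominated component of a vector of `C` to
be stretched by a factor `q > 1` at each unit of time without leaving `C`; this is the domination
estimate.

For the second part, suppose that `x` is not pseudo-ordered. Its orbit then never becomes ordered
with a point of `ω(x)`, so the differences `Φ_t (Φ_τ x) - Φ_t z` stay outside `C` and are controlled
by their components in the dominated bundle. Since `λ_{kz} ≤ 0`, domination makes the linearised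
flow contract that bundle exponentially along the orbit of `z`, while the Hölder condition makes the
nonlinear remainder superlinear; hence `Φ_t (Φ_τ x) - Φ_t z → 0` as soon as `Φ_τ x` is close to `z`.
This applies to all `τ` in an interval, and comparing two of them shows that `Φ_s z = z` for small
`s`.
-/

namespace KCone

section Margin

variable {V W : Type*} [NormedAddCommGroup V] [NormedSpace ℝ V] [NormedAddCommGroup W]
  [NormedSpace ℝ W]

theorem exists_uniform_margin {X : Type*} [TopologicalSpace X] [FiniteDimensional ℝ V] {K : Set X}
    {P : Set V} {O : Set W} {T : X → V →L[ℝ] W} (hT : Continuous T) (hK : IsCompact K)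
    (hP : IsClosed P) (hO : IsOpen O) (smul_mem_P : ∀ v ∈ P, ∀ l : ℝ, l • v ∈ P)
    (smul_mem_O : ∀ v ∈ O, ∀ l : ℝ, l ≠ 0 → l • v ∈ O)
    (mapsTo : ∀ y ∈ K, ∀ u ∈ P, u ≠ 0 → T y u ∈ O) :
    ∃ ε : ℝ, 0 < ε ∧ ∀ y ∈ K, ∀ u ∈ P, u ≠ 0 → ∀ w, ‖w - T y u‖ ≤ ε * ‖T y u‖ → w ∈ O := by
  have image_compact : IsCompact ((fun p : X × V => T p.1 p.2) '' K ×ˢ (P ∩ Metric.sphere 0 1)) :=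
    (hK.prod ((isCompact_sphere 0 1).inter_left hP)).image (by fun_prop)
  obtain ⟨δ, hδ, thickening_subset⟩ := image_compact.exists_cthickening_subset_open hO (by
    rintro _ ⟨⟨y, u⟩, ⟨hy, hu, hu1⟩, rfl⟩
    exact mapsTo y hy u hu (ne_zero_of_mem_unit_sphere ⟨u, hu1⟩))
  obtain ⟨B, hB, image_le⟩ := image_compact.isBounded.exists_pos_norm_le
  refine ⟨δ / B, by positivity, fun y hy u hu hu0 w hw => ?_⟩
  have norm_pos : 0 < ‖u‖ := norm_pos_iff.2 hu0
  have unit_mem : ‖u‖⁻¹ • T y u ∈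
      (fun p : X × V => T p.1 p.2) '' K ×ˢ (P ∩ Metric.sphere 0 1) :=
    ⟨(y, ‖u‖⁻¹ • u), ⟨hy, smul_mem_P u hu _, by simp [norm_smul, norm_pos.ne']⟩, by simp⟩
  have scaled_mem : ‖u‖⁻¹ • w ∈ O := by
    refine thickening_subset (Metric.mem_cthickening_of_dist_le _ _ _ _ unit_mem ?_)
    calc dist (‖u‖⁻¹ • w) (‖u‖⁻¹ • T y u) = ‖u‖⁻¹ * ‖w - T y u‖ := by
          rw [dist_eq_norm, ← smul_sub, norm_smul, norm_inv, norm_norm]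
      _ ≤ ‖u‖⁻¹ * (δ / B * ‖T y u‖) := by gcongr
      _ = δ / B * ‖‖u‖⁻¹ • T y u‖ := by rw [norm_smul, norm_inv, norm_norm]; ring
      _ ≤ δ / B * B := by gcongr; exact image_le _ unit_mem
      _ = δ := by field_simp
  simpa [smul_smul, norm_pos.ne'] using smul_mem_O _ scaled_mem ‖u‖ norm_pos.ne'

section Orbit

variable {P : Set W} {B : ℕ → V →L[ℝ] W} {ε : ℝ}

theorem orbit_mem_of_le (hε : 0 < ε)
    (margin : ∀ n u w, B (n + 1) u ∈ P → ‖w - B n u‖ ≤ ε * ‖B n u‖ → w ∈ P) {v : V} {m n : ℕ}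
    (hmn : m ≤ n) (hv : B n v ∈ P) : B m v ∈ P := by
  induction n, hmn using Nat.le_induction with
  | base => exact hv
  | succ n _ ih => exact ih (margin n v _ hv (by simp only [sub_self, norm_zero]; positivity))

theorem eventually_orbit_add_smul_mem (hε : 0 < ε) (smul_mem : ∀ v ∈ P, ∀ l : ℝ, l • v ∈ P)
    (margin : ∀ n u w, B (n + 1) u ∈ P → ‖w - B n u‖ ≤ ε * ‖B n u‖ → w ∈ P) {u v : V}
    (hu : ∀ n, B n u ∈ P) (hv : ∀ n, B n v ∈ P) : ∀ᶠ s : ℝ in 𝓝 0, ∀ n, B n (u + s • v) ∈ P := by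
  -- Either `B n v` is infinitely often bounded by a multiple of `B n u`, and a small multiple of
  -- `v` stays in the margin of `u`, or `B n u` is eventually negligible and `u` stays in the margin
  -- of `s • v`.
  by_cases dominated : ∃ c : ℝ, 0 < c ∧ ∃ᶠ n in atTop, c * ‖B n v‖ ≤ ‖B n u‖
  · obtain ⟨c, hc, dominated⟩ := dominated
    filter_upwards [Metric.ball_mem_nhds 0 (mul_pos hε hc)] with s hs n
    obtain ⟨m, hm, hle⟩ := frequently_atTop.1 dominated n
    refine orbit_mem_of_le hε margin hm (margin m u _ (hu _) ?_)
    calc ‖B m (u + s • v) - B m u‖ = ‖s‖ * ‖B m v‖ := by simp [norm_smul]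
      _ ≤ ε * c * ‖B m v‖ := by gcongr; exact (mem_ball_zero_iff.1 hs).le
      _ ≤ ε * ‖B m u‖ := by rw [mul_assoc]; gcongr
  · simp only [not_exists, not_and, not_frequently, not_le] at dominated
    refine Eventually.of_forall fun s n => ?_
    rcases eq_or_ne s 0 with rfl | hs
    · simpa using hu n
    have radius_pos : 0 < ε * ‖s‖ := mul_pos hε (norm_pos_iff.2 hs)
    obtain ⟨m, hlt, hm⟩ :=
      ((dominated (ε * ‖s‖) radius_pos).and (eventually_ge_atTop n)).exists
    refine orbit_mem_of_le hε margin hm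
      (margin m (s • v) _ (by simpa using smul_mem _ (hv _) s) ?_)
    calc ‖B m (u + s • v) - B m (s • v)‖ = ‖B m u‖ := by simp
      _ ≤ ε * ‖B m (s • v)‖ := by rw [map_smul, norm_smul, ← mul_assoc]; exact hlt.le

theorem mem_span_orbit_mem_iff (hε : 0 < ε) (hP : IsClosed P) (zero_mem : (0 : W) ∈ P)
    (smul_mem : ∀ v ∈ P, ∀ l : ℝ, l • v ∈ P)
    (margin : ∀ n u w, B (n + 1) u ∈ P → ‖w - B n u‖ ≤ ε * ‖B n u‖ → w ∈ P) {v : V} :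
    v ∈ Submodule.span ℝ {v | ∀ n, B n v ∈ P} ↔ ∀ n, B n v ∈ P := by
  refine ⟨fun hv => ?_, fun hv => Submodule.subset_span hv⟩
  induction hv using Submodule.span_induction with
  | mem _ hv => exact hv
  | zero => exact fun n => by simpa using zero_mem
  | smul l _ _ hv => intro n; simpa using smul_mem _ (hv n) l
  | add u v _ _ hu hv =>
    have isClosed : IsClosed {r : ℝ | ∀ n, B n (u + r • v) ∈ P} := by
      simp only [ofPred_forall]
      exact isClosed_iInter fun n => hP.preimage (by fun_prop)
    have isOpen : IsOpen {r : ℝ | ∀ n, B n (u + r • v) ∈ P} := by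
      refine isOpen_iff_mem_nhds.2 fun r hr => ?_
      have near := eventually_orbit_add_smul_mem hε smul_mem margin hr hv
      rw [← sub_self r] at near
      filter_upwards [(continuous_sub_right r).continuousAt.eventually near] with s hs
      simpa [add_assoc, ← add_smul] using hs
    have eq_univ : {r : ℝ | ∀ n, B n (u + r • v) ∈ P} = univ :=
      IsClopen.eq_univ ⟨isClosed, isOpen⟩ ⟨0, by simpa using hu⟩
    simpa using eq_univ.ge (mem_univ 1)

end Orbit

end Margin

section Grassmannian

theorem isCompact_setOf_orthonormal {ι H : Type*} [Finite ι] [NormedAddCommGroup H]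
    [InnerProductSpace ℝ H] [FiniteDimensional ℝ H] : IsCompact {f : ι → H | Orthonormal ℝ f} := by
  classical
  have := Fintype.ofFinite ι
  refine Metric.isCompact_of_isClosed_isBounded ?_ ?_
  · simp only [orthonormal_iff_ite, ofPred_forall]
    refine isClosed_iInter fun i => isClosed_iInter fun j => isClosed_eq ?_ continuous_const
    fun_prop
  · refine Metric.isBounded_closedBall.subset fun f hf =>
      mem_closedBall_zero_iff.2 ((pi_norm_le_iff_of_nonneg zero_le_one).2 fun i => (hf.1 i).le)

theorem exists_submodule_subset_iInter_of_innerProductSpace {H : Type*} [NormedAddCommGroup H]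
    [InnerProductSpace ℝ H] [FiniteDimensional ℝ H] {k : ℕ} {S : ℕ → Set H}
    (closed : ∀ n, IsClosed (S n)) (anti : Antitone S)
    (hS : ∀ n, ∃ L : Submodule ℝ H, Module.finrank ℝ L = k ∧ (L : Set H) ⊆ S n) :
    ∃ L : Submodule ℝ H, Module.finrank ℝ L = k ∧ (L : Set H) ⊆ ⋂ n, S n := by
  let frames (n : ℕ) : Set (Fin k → H) :=
    {f | Orthonormal ℝ f} ∩ {f | ∀ c : Fin k → ℝ, ∑ i, c i • f i ∈ S n}
  have frames_closed (n : ℕ) : IsClosed (frames n) := by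
    refine isCompact_setOf_orthonormal.isClosed.inter ?_
    simp only [ofPred_forall]
    exact isClosed_iInter fun c => (closed n).preimage (by fun_prop)
  have frames_nonempty (n : ℕ) : (frames n).Nonempty := by
    obtain ⟨L, hL, hLS⟩ := hS n
    let b := (stdOrthonormalBasis ℝ L).reindex (finCongr hL)
    exact ⟨fun i => b i, b.orthonormal.comp_linearIsometry L.subtypeₗᵢ,
      fun c => hLS (L.sum_mem fun i _ => L.smul_mem _ (b i).2)⟩
  obtain ⟨f, hf⟩ := IsCompact.nonempty_iInter_of_sequence_nonempty_isCompact_isClosed frames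
    (fun n => inter_subset_inter_right _ fun f hf c => anti n.le_succ (hf c)) frames_nonempty
    (isCompact_setOf_orthonormal.inter_right <| by
      simp only [ofPred_forall]
      exact isClosed_iInter fun c => (closed 0).preimage (by fun_prop)) frames_closed
  rw [mem_iInter] at hf
  refine ⟨Submodule.span ℝ (range f), ?_, fun v hv => mem_iInter.2 fun n => ?_⟩
  · simpa using finrank_span_eq_card (hf 0).1.linearIndependent
  · obtain ⟨c, rfl⟩ := (Submodule.mem_span_range_iff_exists_fun ℝ).1 hv
    exact (hf n).2 c

theorem exists_submodule_subset_iInter {V : Type*} [NormedAddCommGroup V] [NormedSpace ℝ V]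
    [FiniteDimensional ℝ V] {k : ℕ} {S : ℕ → Set V} (closed : ∀ n, IsClosed (S n))
    (anti : Antitone S)
    (hS : ∀ n, ∃ L : Submodule ℝ V, Module.finrank ℝ L = k ∧ (L : Set V) ⊆ S n) :
    ∃ L : Submodule ℝ V, Module.finrank ℝ L = k ∧ (L : Set V) ⊆ ⋂ n, S n := by
  let φ : V ≃L[ℝ] EuclideanSpace ℝ (Fin (Module.finrank ℝ V)) := toEuclidean
  have transfer (n : ℕ) : ∃ L : Submodule ℝ (EuclideanSpace ℝ (Fin (Module.finrank ℝ V))),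
      Module.finrank ℝ L = k ∧ (L : Set _) ⊆ φ.symm ⁻¹' S n := by
    obtain ⟨L, hL, hLS⟩ := hS n
    refine ⟨L.map (φ : V →ₗ[ℝ] _), hL ▸ φ.toLinearEquiv.finrank_map_eq L, ?_⟩
    rintro _ ⟨v, hv, rfl⟩
    simpa using hLS hv
  obtain ⟨L, hL, hLS⟩ := exists_submodule_subset_iInter_of_innerProductSpace
    (fun n => (closed n).preimage φ.symm.continuous)
    (fun m n hmn => preimage_mono (anti hmn)) transfer
  refine ⟨L.map (φ.symm : _ →ₗ[ℝ] V), hL ▸ φ.symm.toLinearEquiv.finrank_map_eq L, ?_⟩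
  rintro _ ⟨v, hv, rfl⟩
  exact mem_iInter.2 fun n => mem_iInter.1 (hLS hv) n

end Grassmannian

section Gap

variable {V : Type*} [NormedAddCommGroup V] [NormedSpace ℝ V]

theorem norm_inv_norm_smul_sub_le {w l : V} (hl : ‖l‖ = 1) :
    ‖‖w‖⁻¹ • w - l‖ ≤ 2 * ‖w - l‖ := by
  rcases eq_or_ne w 0 with rfl | hw
  · simp [hl]
  have normalize : ‖‖w‖⁻¹ • w - w‖ = |‖l‖ - ‖w‖| := by
    rw [show ‖w‖⁻¹ • w - w = (‖w‖⁻¹ - 1) • w by rw [sub_smul, one_smul], norm_smul,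
      Real.norm_eq_abs, ← abs_norm w, ← abs_mul, abs_norm, hl, sub_mul,
      inv_mul_cancel₀ (norm_ne_zero_iff.2 hw), one_mul]
  calc ‖‖w‖⁻¹ • w - l‖ ≤ ‖‖w‖⁻¹ • w - w‖ + ‖w - l‖ := norm_sub_le_norm_sub_add_norm_sub _ _ _
    _ ≤ ‖w - l‖ + ‖w - l‖ := by
      gcongr
      rw [normalize, norm_sub_rev]
      exact abs_norm_sub_norm_le l w
    _ = 2 * ‖w - l‖ := by ring

theorem exists_proj_eq_of_finrank_eq {L N : Submodule ℝ V} [FiniteDimensional ℝ L]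
    [FiniteDimensional ℝ N] (finrank_eq : Module.finrank ℝ N = Module.finrank ℝ L)
    {p : V →L[ℝ] L} {δ : ℝ} (hδ : δ < 1) (close : ∀ w ∈ N, ‖w - p w‖ ≤ δ * ‖w‖) (l : L) :
    ∃ w ∈ N, p w = l := by
  have injective : Function.Injective ((p : V →ₗ[ℝ] L) ∘ₗ N.subtype) := by
    refine (injective_iff_map_eq_zero _).2 fun w hw => ?_
    have hp : p w = 0 := hw
    have := close w w.2
    rw [hp, ZeroMemClass.coe_zero, sub_zero] at this
    have : ‖(w : V)‖ = 0 := by nlinarith [norm_nonneg (w : V)]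
    exact Subtype.ext (norm_eq_zero.1 this)
  obtain ⟨w, hw⟩ :=
    (LinearMap.injective_iff_surjective_of_finrank_eq_finrank finrank_eq).1 injective l
  exact ⟨w, w.2, hw⟩

theorem gapDist_le_of_norm_sub_proj_le {L N : Submodule ℝ V} [FiniteDimensional ℝ L]
    [FiniteDimensional ℝ N] (finrank_eq : Module.finrank ℝ N = Module.finrank ℝ L)
    {p : V →L[ℝ] L} {δ : ℝ} (hδ0 : 0 ≤ δ) (hδ : δ ≤ 1 / 2)
    (close : ∀ w ∈ N, ‖w - p w‖ ≤ δ * ‖w‖) : gapDist N L ≤ 4 * δ := by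
  have normalize {M : Submodule ℝ V} {w v : V} (hw : w ∈ M) (hv : ‖v‖ = 1) (hwv : ‖w - v‖ ≤ 2 * δ)
      (hw0 : w ≠ 0) : ∃ u ∈ (M : Set V) ∩ Metric.sphere 0 1, dist v u ≤ 4 * δ := by
    refine ⟨‖w‖⁻¹ • w, ⟨M.smul_mem _ hw, by simp [norm_smul, hw0]⟩, ?_⟩
    rw [dist_comm, dist_eq_norm]
    linarith [norm_inv_norm_smul_sub_le (w := w) hv]
  refine Metric.hausdorffDist_le_of_mem_dist (by positivity) ?_ ?_
  · rintro w ⟨hw, hw1⟩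
    rw [mem_sphere_zero_iff_norm] at hw1
    have hwp : ‖w - p w‖ ≤ δ := by simpa [hw1] using close w hw
    refine normalize (p w).2 hw1 (by rw [norm_sub_rev]; linarith) fun h => ?_
    rw [h, sub_zero] at hwp
    linarith
  · rintro l ⟨hl, hl1⟩
    rw [mem_sphere_zero_iff_norm] at hl1
    obtain ⟨w, hw, hpw⟩ := exists_proj_eq_of_finrank_eq finrank_eq (by linarith) close ⟨l, hl⟩
    have hwl : ‖w - l‖ ≤ δ * ‖w‖ := by simpa [hpw] using close w hw
    have norm_le : ‖w‖ ≤ ‖w - l‖ + 1 := hl1 ▸ norm_le_norm_sub_add w l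
    refine normalize hw hl1 (by nlinarith [norm_nonneg w]) ?_
    rintro rfl
    simp [hl1] at hwl
    linarith

theorem eventually_forall_mem_dist_lt {X : Type*} [TopologicalSpace X] [FiniteDimensional ℝ V]
    {K : Set X} {Y : X → Submodule ℝ V} {Γ : Set (X × V)} (hΓ : IsClosed Γ)
    (mem_iff : ∀ x ∈ K, ∀ v, v ∈ Y x ↔ (x, v) ∈ Γ) {x : X} (hx : x ∈ K) {δ : ℝ} (hδ : 0 < δ) :
    ∀ᶠ y in 𝓝[K] x, ∀ w ∈ Y y, ‖w‖ = 1 → ∃ l ∈ Y x, dist w l < δ := by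
  have far_compact : IsCompact (Metric.sphere (0 : V) 1 \ Metric.thickening δ (Y x)) :=
    (isCompact_sphere 0 1).diff Metric.isOpen_thickening
  have avoid := far_compact.eventually_forall_of_forall_eventually (x₀ := x)
    (P := fun y w => (y, w) ∉ Γ) fun w hw => hΓ.isOpen_compl.mem_nhds fun hmem =>
      hw.2 (Metric.self_subset_thickening hδ _ ((mem_iff x hx w).2 hmem))
  filter_upwards [avoid.filter_mono nhdsWithin_le_nhds, self_mem_nhdsWithin] with y hy hyK w hw hw1
  by_contra far
  exact hy w ⟨mem_sphere_zero_iff_norm.2 hw1, fun near => far (Metric.mem_thickening_iff.1 near)⟩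
    ((mem_iff y hyK w).1 hw)

theorem norm_sub_proj_le {L N : Submodule ℝ V} {p : V →L[ℝ] L} (hp : ∀ l : L, p l = l) {δ : ℝ}
    (near : ∀ w ∈ N, ‖w‖ = 1 → ∃ l ∈ L, dist w l < δ) {w : V} (hw : w ∈ N) :
    ‖w - p w‖ ≤ (1 + ‖p‖) * δ * ‖w‖ := by
  rcases eq_or_ne w 0 with rfl | hw0
  · simp
  have norm_pos : 0 < ‖w‖ := norm_pos_iff.2 hw0
  obtain ⟨l, hl, hwl⟩ := near (‖w‖⁻¹ • w) (N.smul_mem _ hw) (by simp [norm_smul, hw0])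
  have scaled : ‖w - ‖w‖ • l‖ ≤ δ * ‖w‖ := by
    calc ‖w - ‖w‖ • l‖ = ‖w‖ * ‖‖w‖⁻¹ • w - l‖ := by
          rw [← norm_norm w, ← norm_smul, smul_sub, smul_smul, norm_norm,
            mul_inv_cancel₀ norm_pos.ne', one_smul]
      _ ≤ δ * ‖w‖ := by rw [mul_comm, ← dist_eq_norm]; gcongr
  have proj_eq : (p (w - ‖w‖ • l) : V) = p w - ‖w‖ • l := by
    rw [map_sub, map_smul, hp ⟨l, hl⟩]; rfl
  calc ‖w - p w‖ = ‖(w - ‖w‖ • l) - p (w - ‖w‖ • l)‖ := by rw [proj_eq]; congr 1; abel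
    _ ≤ ‖w - ‖w‖ • l‖ + ‖p‖ * ‖w - ‖w‖ • l‖ :=
      (norm_sub_le _ _).trans (by gcongr; exact p.le_opNorm _)
    _ = (1 + ‖p‖) * ‖w - ‖w‖ • l‖ := by ring
    _ ≤ (1 + ‖p‖) * (δ * ‖w‖) := by gcongr
    _ = (1 + ‖p‖) * δ * ‖w‖ := by ring

theorem isContinuousBundle_of_isClosed [FiniteDimensional ℝ V] {K : Set V} {d : ℕ}
    {Y : V → Submodule ℝ V} (finrank_eq : ∀ x ∈ K, Module.finrank ℝ (Y x) = d) {Γ : Set (V × V)}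
    (hΓ : IsClosed Γ) (mem_iff : ∀ x ∈ K, ∀ v, v ∈ Y x ↔ (x, v) ∈ Γ) :
    IsContinuousBundle K d Y := by
  refine ⟨finrank_eq, fun x hx => ?_⟩
  obtain ⟨p, hp⟩ := Submodule.ClosedComplemented.of_finiteDimensional (Y x)
  refine Metric.tendsto_nhds.2 fun ε hε => ?_
  obtain ⟨δ, hδ, hδε⟩ := exists_between (lt_min one_half_pos (by positivity : 0 < ε / 4))
  have hδ_pos : 0 < δ / (1 + ‖p‖) := by positivity
  filter_upwards [eventually_forall_mem_dist_lt hΓ mem_iff hx hδ_pos, self_mem_nhdsWithin]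
    with y near hy
  have gap_le : gapDist (Y y) (Y x) ≤ 4 * δ :=
    gapDist_le_of_norm_sub_proj_le (p := p) ((finrank_eq y hy).trans (finrank_eq x hx).symm) hδ.le
      (hδε.le.trans (min_le_left _ _)) fun w hw =>
        (norm_sub_proj_le hp near hw).trans_eq (by field_simp)
  rw [Real.dist_0_eq_abs, abs_of_nonneg (by exact Metric.hausdorffDist_nonneg)]
  linarith [hδε.trans_le (min_le_right _ _)]

end Gap

section FlowDeriv

theorem flow_flow_neg {X : Type*} [TopologicalSpace X] (Φ : Flow ℝ X) (t : ℝ) (x : X) :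
    Φ t (Φ (-t) x) = x := by
  rw [← Φ.map_add, add_neg_cancel, Φ.map_zero_apply]

variable {V : Type*} [NormedAddCommGroup V] [NormedSpace ℝ V] {Φ : Flow ℝ V}

theorem flowDeriv_zero (y v : V) : flowDeriv Φ 0 y v = v := by
  rw [flowDeriv, Φ.map_zero, fderiv_id, ContinuousLinearMap.id_apply]

theorem flowDeriv_add (hΦ : ∀ t, Differentiable ℝ (Φ t)) (s t : ℝ) (y v : V) :
    flowDeriv Φ (s + t) y v = flowDeriv Φ s (Φ t y) (flowDeriv Φ t y v) := by
  have comp : (Φ (s + t) : V → V) = Φ s ∘ Φ t := funext fun x => Φ.map_add s t x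
  rw [flowDeriv, comp, fderiv_comp y (hΦ s _) (hΦ t y)]
  rfl

theorem flowDeriv_neg_flowDeriv (hΦ : ∀ t, Differentiable ℝ (Φ t)) (t : ℝ) (y v : V) :
    flowDeriv Φ (-t) (Φ t y) (flowDeriv Φ t y v) = v := by
  rw [← flowDeriv_add hΦ, neg_add_cancel, flowDeriv_zero]

theorem flowDeriv_flowDeriv_neg (hΦ : ∀ t, Differentiable ℝ (Φ t)) (t : ℝ) (y v : V) :
    flowDeriv Φ t (Φ (-t) y) (flowDeriv Φ (-t) y v) = v := by
  rw [← flowDeriv_add hΦ, add_neg_cancel, flowDeriv_zero]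

theorem flowDeriv_injective (hΦ : ∀ t, Differentiable ℝ (Φ t)) (t : ℝ) (y : V) :
    Function.Injective (flowDeriv Φ t y) :=
  Function.LeftInverse.injective (flowDeriv_neg_flowDeriv hΦ t y)

theorem flowDeriv_ne_zero (hΦ : ∀ t, Differentiable ℝ (Φ t)) (t : ℝ) (y : V) {v : V}
    (hv : v ≠ 0) : flowDeriv Φ t y v ≠ 0 := by
  rwa [Ne, map_eq_zero_iff _ (flowDeriv_injective hΦ t y)]

theorem finrank_map_flowDeriv (hΦ : ∀ t, Differentiable ℝ (Φ t)) (t : ℝ) (y : V)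
    (L : Submodule ℝ V) :
    Module.finrank ℝ (L.map (flowDeriv Φ t y : V →ₗ[ℝ] V)) = Module.finrank ℝ L :=
  (Submodule.equivMapOfInjective _ (flowDeriv_injective hΦ t y) L).finrank_eq.symm

theorem differentiable_flow (hΦ : ContDiff ℝ 1 fun p : ℝ × V => Φ p.1 p.2) (t : ℝ) :
    Differentiable ℝ (Φ t) :=
  (hΦ.comp (contDiff_prodMk_right t)).differentiable one_ne_zero

theorem continuous_flowDeriv (hΦ : ContDiff ℝ 1 fun p : ℝ × V => Φ p.1 p.2) :
    Continuous fun p : ℝ × V => flowDeriv Φ p.1 p.2 :=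
  (ContDiff.fderiv (m := 1) (n := 0) (f := fun p : ℝ × V => Φ p.1) (g := Prod.snd)
    (hΦ.comp (contDiff_fst.fst.prodMk contDiff_snd)) contDiff_snd (zero_add 1).le).continuous

theorem exists_mul_norm_le_norm_flowDeriv (hΦ : ContDiff ℝ 1 fun p : ℝ × V => Φ p.1 p.2)
    {K : Set V} (hK : IsCompact K) (t : ℝ) :
    ∃ c : ℝ, 0 < c ∧ ∀ y ∈ K, ∀ v, c * ‖v‖ ≤ ‖flowDeriv Φ t y v‖ := by
  have inverse_continuous : Continuous fun y => flowDeriv Φ (-t) (Φ t y) :=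
    (continuous_flowDeriv hΦ).comp (continuous_const.prodMk (Φ.continuous_toFun t))
  obtain ⟨B, hB, inverse_le⟩ := (hK.image inverse_continuous).isBounded.exists_pos_norm_le
  refine ⟨B⁻¹, by positivity, fun y hy v => (inv_mul_le_iff₀ hB).2 ?_⟩
  calc ‖v‖ = ‖flowDeriv Φ (-t) (Φ t y) (flowDeriv Φ t y v)‖ := by
        rw [flowDeriv_neg_flowDeriv (differentiable_flow hΦ)]
    _ ≤ B * ‖flowDeriv Φ t y v‖ := ContinuousLinearMap.le_of_opNorm_le _
        (inverse_le _ (mem_image_of_mem _ hy)) _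

end FlowDeriv

section Cone

variable {V : Type*} [NormedAddCommGroup V]

/-- The complementary cone of `C`: the complement of its interior, with the origin added back. -/
def complCone (C : Set V) : Set V := (interior C)ᶜ ∪ {0}

variable {k : ℕ} {C : Set V}

theorem isClosed_complCone : IsClosed (complCone C) :=
  isOpen_interior.isClosed_compl.union isClosed_singleton

theorem mem_complCone {v : V} : v ∈ complCone C ↔ v ∈ interior C → v = 0 :=
  imp_iff_not_or.symm

theorem zero_mem_complCone : (0 : V) ∈ complCone C := Or.inr rfl

variable [NormedSpace ℝ V]

theorem IsKCone.zero_mem (hC : IsKCone k C) : (0 : V) ∈ C := by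
  obtain ⟨L, hL, -⟩ := hC.rank.1
  exact hL L.zero_mem

theorem IsKCone.smul_mem_iff (hC : IsKCone k C) {l : ℝ} (hl : l ≠ 0) {v : V} :
    l • v ∈ C ↔ v ∈ C :=
  ⟨fun h => by simpa [smul_smul, hl] using hC.smul_mem _ h l⁻¹, fun h => hC.smul_mem v h l⟩

theorem IsKCone.smul_mem_interior (hC : IsKCone k C) {l : ℝ} (hl : l ≠ 0) {v : V}
    (hv : v ∈ interior C) : l • v ∈ interior C := by
  have preimage : (fun w : V => l⁻¹ • w) ⁻¹' interior C ⊆ interior C :=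
    interior_maximal
      (fun w hw => (hC.smul_mem_iff (inv_ne_zero hl)).1 (interior_subset (mem_preimage.1 hw)))
      (isOpen_interior.preimage (continuous_const_smul _))
  exact preimage (by simpa [smul_smul, hl] using hv)

theorem IsKCone.smul_mem_complCone (hC : IsKCone k C) {v : V} (hv : v ∈ complCone C) (l : ℝ) :
    l • v ∈ complCone C := by
  refine mem_complCone.2 fun h => ?_
  rcases eq_or_ne l 0 with rfl | hl
  · rw [zero_smul]
  have : v ∈ interior C := by simpa [smul_smul, hl] using hC.smul_mem_interior (inv_ne_zero hl) h
  rw [mem_complCone.1 hv this, smul_zero]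

theorem IsKCone.exists_mem_complCone_of_lt_finrank (hC : IsKCone k C)
    {P : Submodule ℝ V} (hP : k < Module.finrank ℝ P) : ∃ u ∈ P, u ≠ 0 ∧ u ∈ complCone C := by
  by_contra! inside
  refine hP.not_ge (hC.rank.2 ⟨P, fun u hu => ?_, rfl⟩)
  by_contra hu'
  exact inside u hu (ne_of_mem_of_not_mem hC.zero_mem hu').symm
    (Or.inl fun h => hu' (interior_subset h))

end Cone

section Invariance

variable {V : Type*} [NormedAddCommGroup V] [NormedSpace ℝ V] {k : ℕ} {C : Set V} {Φ : Flow ℝ V}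

theorem FWW.contDiff (hΦ : FWW k C Φ) : ContDiff ℝ 1 fun p : ℝ × V => Φ p.1 p.2 := by
  obtain ⟨α, -, -, hα⟩ := hΦ.smooth
  exact hα.1

theorem FWW.differentiable (hΦ : FWW k C Φ) (t : ℝ) : Differentiable ℝ (Φ t) :=
  differentiable_flow hΦ.contDiff t

theorem FWW.deriv_mem_interior_of_lt (hΦ : FWW k C Φ) {s t : ℝ} (hst : s < t) {y v : V}
    (hv0 : v ≠ 0) (hv : flowDeriv Φ s y v ∈ C) : flowDeriv Φ t y v ∈ interior C := by
  rw [← sub_add_cancel t s, flowDeriv_add hΦ.differentiable]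
  exact hΦ.deriv_mapsTo _ _ (sub_pos.2 hst) ⟨hv, flowDeriv_ne_zero hΦ.differentiable _ _ hv0⟩

theorem FWW.deriv_mem_of_le (hΦ : FWW k C Φ) {s t : ℝ} (hst : s ≤ t) {y v : V}
    (hv : flowDeriv Φ s y v ∈ C) : flowDeriv Φ t y v ∈ C := by
  rcases eq_or_ne v 0 with rfl | hv0
  · simpa only [map_zero] using hΦ.isKCone.zero_mem
  rcases hst.eq_or_lt with rfl | hlt
  · exact hv
  · exact interior_subset (hΦ.deriv_mem_interior_of_lt hlt hv0 hv)

theorem FWW.deriv_mem_complCone_of_le (hΦ : FWW k C Φ) {s t : ℝ} (hst : s ≤ t) {y v : V}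
    (hv : flowDeriv Φ t y v ∈ complCone C) : flowDeriv Φ s y v ∈ complCone C := by
  rcases eq_or_ne v 0 with rfl | hv0
  · simpa only [map_zero] using zero_mem_complCone
  rcases hst.eq_or_lt with rfl | hlt
  · exact hv
  · exact mem_complCone.2 fun h => absurd
      (mem_complCone.1 hv (hΦ.deriv_mem_interior_of_lt hlt hv0 (interior_subset h)))
      (flowDeriv_ne_zero hΦ.differentiable t y hv0)

variable [FiniteDimensional ℝ V] {K : Set V}

theorem FWW.exists_margin (hΦ : FWW k C Φ) (hK : IsCompact K) :
    ∃ ε : ℝ, 0 < ε ∧ ∀ y ∈ K, ∀ u ∈ C, u ≠ 0 → ∀ w,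
      ‖w - flowDeriv Φ 1 y u‖ ≤ ε * ‖flowDeriv Φ 1 y u‖ → w ∈ interior C :=
  exists_uniform_margin ((continuous_flowDeriv hΦ.contDiff).comp (Continuous.prodMk_right 1)) hK
    hΦ.isKCone.isClosed isOpen_interior hΦ.isKCone.smul_mem
    (fun _ hv _ hl => hΦ.isKCone.smul_mem_interior hl hv)
    fun y _ _ hu hu0 => hΦ.deriv_mapsTo 1 y one_pos ⟨hu, hu0⟩

theorem FWW.exists_margin_complCone (hΦ : FWW k C Φ) (hK : IsCompact K) :
    ∃ ε : ℝ, 0 < ε ∧ ∀ y ∈ K, ∀ u ∈ complCone C, u ≠ 0 → ∀ w,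
      ‖w - flowDeriv Φ (-1) y u‖ ≤ ε * ‖flowDeriv Φ (-1) y u‖ → w ∉ C := by
  refine exists_uniform_margin (O := Cᶜ)
    ((continuous_flowDeriv hΦ.contDiff).comp (Continuous.prodMk_right (-1))) hK
    isClosed_complCone hΦ.isKCone.isClosed.isOpen_compl
    (fun _ hv => hΦ.isKCone.smul_mem_complCone hv)
    (fun _ hv _ hl => (hΦ.isKCone.smul_mem_iff hl).not.2 hv) fun y _ u hu hu0 hback => hu0 ?_
  have := hΦ.deriv_mem_interior_of_lt neg_one_lt_zero hu0 hback
  exact mem_complCone.1 hu (by rwa [flowDeriv_zero] at this)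

end Invariance

section Bundles

variable {V : Type*} [NormedAddCommGroup V] [NormedSpace ℝ V]

/-- The dominant subspace at `y`: the vectors whose whole orbit under the linearised flow stays in
`C`. They form a subspace when the orbit of `y` is precompact; taking the span makes this a
definition for every `y`. -/
def dominantSpace (C : Set V) (Φ : Flow ℝ V) (y : V) : Submodule ℝ V :=
  Submodule.span ℝ {v | ∀ t : ℝ, flowDeriv Φ t y v ∈ C}

/-- The dominated subspace at `y`: the vectors whose forward orbit under the linearised flow stays
in the complementary cone of `C`; the span plays the same role as in `dominantSpace`. -/
def dominatedSpace (C : Set V) (Φ : Flow ℝ V) (y : V) : Submodule ℝ V :=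
  Submodule.span ℝ {v | ∀ t : ℝ, 0 ≤ t → flowDeriv Φ t y v ∈ complCone C}

variable {k : ℕ} {C : Set V} {Φ : Flow ℝ V}

theorem FWW.forall_deriv_mem_iff (hΦ : FWW k C Φ) {y v : V} :
    (∀ n : ℕ, flowDeriv Φ (-n) y v ∈ C) ↔ ∀ t : ℝ, flowDeriv Φ t y v ∈ C := by
  refine ⟨fun h t => ?_, fun h n => h _⟩
  obtain ⟨n, hn⟩ := exists_nat_ge (-t)
  exact hΦ.deriv_mem_of_le (neg_le.1 hn) (h n)

theorem FWW.forall_deriv_mem_complCone_iff (hΦ : FWW k C Φ) {y v : V} :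
    (∀ n : ℕ, flowDeriv Φ n y v ∈ complCone C) ↔
      ∀ t : ℝ, 0 ≤ t → flowDeriv Φ t y v ∈ complCone C := by
  refine ⟨fun h t _ => ?_, fun h n => h n n.cast_nonneg⟩
  obtain ⟨n, hn⟩ := exists_nat_ge t
  exact hΦ.deriv_mem_complCone_of_le hn (h n)

variable [FiniteDimensional ℝ V] {K : Set V} {y v : V}

theorem FWW.mem_dominantSpace (hΦ : FWW k C Φ) (hK : IsCompact K) (hinv : IsInvariant Φ K)
    (hy : y ∈ K) : v ∈ dominantSpace C Φ y ↔ ∀ t : ℝ, flowDeriv Φ t y v ∈ C := by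
  obtain ⟨ε, hε, margin⟩ := hΦ.exists_margin hK
  simp only [dominantSpace, ← hΦ.forall_deriv_mem_iff]
  refine mem_span_orbit_mem_iff (B := fun n : ℕ => flowDeriv Φ (-n) y) hε hΦ.isKCone.isClosed
    hΦ.isKCone.zero_mem hΦ.isKCone.smul_mem fun n u w hu hw => ?_
  rcases eq_or_ne u 0 with rfl | hu0
  · have : w = 0 := by simpa using hw
    exact this ▸ hΦ.isKCone.zero_mem
  rw [show -(n : ℝ) = 1 + -(n + 1 : ℕ) by push_cast; ring, flowDeriv_add hΦ.differentiable] at hw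
  exact interior_subset
    (margin _ (hinv _ hy) _ hu (flowDeriv_ne_zero hΦ.differentiable _ _ hu0) w hw)

theorem FWW.mem_dominatedSpace (hΦ : FWW k C Φ) (hK : IsCompact K) (hinv : IsInvariant Φ K)
    (hy : y ∈ K) :
    v ∈ dominatedSpace C Φ y ↔ ∀ t : ℝ, 0 ≤ t → flowDeriv Φ t y v ∈ complCone C := by
  obtain ⟨ε, hε, margin⟩ := hΦ.exists_margin_complCone hK
  simp only [dominatedSpace, ← hΦ.forall_deriv_mem_complCone_iff]
  refine mem_span_orbit_mem_iff (B := fun n : ℕ => flowDeriv Φ n y) hε isClosed_complCone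
    zero_mem_complCone (fun _ => hΦ.isKCone.smul_mem_complCone) fun n u w hu hw => ?_
  rcases eq_or_ne u 0 with rfl | hu0
  · have : w = 0 := by simpa using hw
    exact this ▸ zero_mem_complCone
  rw [show (n : ℝ) = -1 + (n + 1 : ℕ) by push_cast; ring, flowDeriv_add hΦ.differentiable] at hw
  exact Or.inl fun h => margin _ (hinv _ hy) _ hu (flowDeriv_ne_zero hΦ.differentiable _ _ hu0) w hw
    (interior_subset h)

theorem FWW.dominantSpace_subset (hΦ : FWW k C Φ) (hK : IsCompact K) (hinv : IsInvariant Φ K)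
    (hy : y ∈ K) : (dominantSpace C Φ y : Set V) ⊆ interior C ∪ {0} := by
  intro v hv
  rcases eq_or_ne v 0 with rfl | hv0
  · exact Or.inr rfl
  have := hΦ.deriv_mem_interior_of_lt neg_one_lt_zero hv0 ((hΦ.mem_dominantSpace hK hinv hy).1 hv _)
  exact Or.inl (by rwa [flowDeriv_zero] at this)

theorem FWW.dominatedSpace_inter (hΦ : FWW k C Φ) (hK : IsCompact K) (hinv : IsInvariant Φ K)
    (hy : y ∈ K) : (dominatedSpace C Φ y : Set V) ∩ C = {0} := by
  refine Subset.antisymm (fun v hv => ?_)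
    (singleton_subset_iff.2 ⟨zero_mem _, hΦ.isKCone.zero_mem⟩)
  by_contra hv0
  exact flowDeriv_ne_zero hΦ.differentiable 1 y hv0 (mem_complCone.1
    ((hΦ.mem_dominatedSpace hK hinv hy).1 hv.1 1 zero_le_one)
    (hΦ.deriv_mapsTo 1 y one_pos ⟨hv.2, hv0⟩))

theorem FWW.deriv_mem_dominantSpace (hΦ : FWW k C Φ) (hK : IsCompact K) (hinv : IsInvariant Φ K)
    (hy : y ∈ K) (hv : v ∈ dominantSpace C Φ y) (t : ℝ) :
    flowDeriv Φ t y v ∈ dominantSpace C Φ (Φ t y) := by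
  refine (hΦ.mem_dominantSpace hK hinv (hinv t hy)).2 fun s => ?_
  rw [← flowDeriv_add hΦ.differentiable]
  exact (hΦ.mem_dominantSpace hK hinv hy).1 hv _

theorem FWW.deriv_mem_dominatedSpace (hΦ : FWW k C Φ) (hK : IsCompact K) (hinv : IsInvariant Φ K)
    (hy : y ∈ K) (hv : v ∈ dominatedSpace C Φ y) {t : ℝ} (ht : 0 ≤ t) :
    flowDeriv Φ t y v ∈ dominatedSpace C Φ (Φ t y) := by
  refine (hΦ.mem_dominatedSpace hK hinv (hinv t hy)).2 fun s hs => ?_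
  rw [← flowDeriv_add hΦ.differentiable]
  exact (hΦ.mem_dominatedSpace hK hinv hy).1 hv _ (add_nonneg hs ht)

theorem FWW.finrank_dominantSpace (hΦ : FWW k C Φ) (hK : IsCompact K) (hinv : IsInvariant Φ K)
    (hy : y ∈ K) : Module.finrank ℝ (dominantSpace C Φ y) = k := by
  have subset_cone : (dominantSpace C Φ y : Set V) ⊆ C := fun v hv => by
    simpa only [flowDeriv_zero] using (hΦ.mem_dominantSpace hK hinv hy).1 hv 0
  refine le_antisymm (hΦ.isKCone.rank.2 ⟨_, subset_cone, rfl⟩) ?_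
  obtain ⟨W, hW, hWC⟩ := hΦ.isKSolid
  have hWC' : (W : Set V) ⊆ C := fun w hw => by
    rcases eq_or_ne w 0 with rfl | hw0
    · exact hΦ.isKCone.zero_mem
    · exact interior_subset (hWC ⟨hw, hw0⟩)
  obtain ⟨L, hL, hLC⟩ := exists_submodule_subset_iInter (k := k)
    (S := fun n : ℕ => flowDeriv Φ (-n) y ⁻¹' C)
    (fun n => hΦ.isKCone.isClosed.preimage (flowDeriv Φ _ y).continuous)
    (fun m n hmn v hv => hΦ.deriv_mem_of_le (neg_le_neg (Nat.cast_le.2 hmn)) hv) fun n => by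
      refine ⟨_, (finrank_map_flowDeriv hΦ.differentiable n (Φ (-n) y) W).trans hW, ?_⟩
      rintro _ ⟨w, hw, rfl⟩
      have cancel := flowDeriv_neg_flowDeriv hΦ.differentiable n (Φ (-n) y) w
      rw [flow_flow_neg] at cancel
      exact mem_preimage.2 (by simpa only [ContinuousLinearMap.coe_coe, cancel] using hWC' hw)
  rw [← hL]
  exact Submodule.finrank_mono fun v hv => (hΦ.mem_dominantSpace hK hinv hy).2
    (hΦ.forall_deriv_mem_iff.1 fun n => mem_iInter.1 (hLC hv) n)

theorem FWW.map_dominantSpace (hΦ : FWW k C Φ) (hK : IsCompact K) (hinv : IsInvariant Φ K)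
    (hy : y ∈ K) (t : ℝ) :
    (dominantSpace C Φ y).map (flowDeriv Φ t y : V →ₗ[ℝ] V) = dominantSpace C Φ (Φ t y) := by
  refine Submodule.eq_of_le_of_finrank_eq ?_ ?_
  · rintro _ ⟨v, hv, rfl⟩
    exact hΦ.deriv_mem_dominantSpace hK hinv hy hv t
  · rw [finrank_map_flowDeriv hΦ.differentiable, hΦ.finrank_dominantSpace hK hinv hy,
      hΦ.finrank_dominantSpace hK hinv (hinv t hy)]

theorem FWW.exists_mem_dominatedSpace_of_lt_finrank (hΦ : FWW k C Φ) (hK : IsCompact K)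
    (hinv : IsInvariant Φ K) (hy : y ∈ K) {P : Submodule ℝ V} (hP : k < Module.finrank ℝ P) :
    ∃ u ∈ P, u ≠ 0 ∧ u ∈ dominatedSpace C Φ y := by
  let trapped (n : ℕ) : Set V :=
    (P : Set V) ∩ Metric.sphere 0 1 ∩ flowDeriv Φ n y ⁻¹' complCone C
  have trapped_compact (n : ℕ) : IsCompact (trapped n) :=
    ((isCompact_sphere 0 1).inter_left P.closed_of_finiteDimensional).inter_right
      (isClosed_complCone.preimage (flowDeriv Φ n y).continuous)
  have trapped_nonempty (n : ℕ) : (trapped n).Nonempty := by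
    rw [← finrank_map_flowDeriv hΦ.differentiable n y P] at hP
    obtain ⟨_, ⟨u, hu, rfl⟩, hu0, hu'⟩ := hΦ.isKCone.exists_mem_complCone_of_lt_finrank hP
    have norm_ne : ‖u‖ ≠ 0 := fun h => hu0 (by simp [norm_eq_zero.1 h])
    exact ⟨‖u‖⁻¹ • u, ⟨P.smul_mem _ hu, by simp [norm_smul, norm_ne]⟩,
      by simpa using hΦ.isKCone.smul_mem_complCone hu' _⟩
  obtain ⟨u, hu⟩ := IsCompact.nonempty_iInter_of_sequence_nonempty_isCompact_isClosed trapped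
    (fun n => inter_subset_inter_right _ fun u hu =>
      hΦ.deriv_mem_complCone_of_le (Nat.cast_le.2 n.le_succ) hu)
    trapped_nonempty (trapped_compact 0) fun n => (trapped_compact n).isClosed
  rw [mem_iInter] at hu
  exact ⟨u, (hu 0).1.1, ne_zero_of_mem_unit_sphere ⟨u, (hu 0).1.2⟩,
    (hΦ.mem_dominatedSpace hK hinv hy).2 (hΦ.forall_deriv_mem_complCone_iff.1 fun n => (hu n).2)⟩

theorem FWW.isCompl_dominantSpace (hΦ : FWW k C Φ) (hK : IsCompact K) (hinv : IsInvariant Φ K)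
    (hy : y ∈ K) : IsCompl (dominantSpace C Φ y) (dominatedSpace C Φ y) := by
  have disjoint : Disjoint (dominantSpace C Φ y) (dominatedSpace C Φ y) := by
    refine Submodule.disjoint_def.2 fun v hv hv' => ?_
    refine (hΦ.dominantSpace_subset hK hinv hy hv).elim (fun hC => ?_) id
    exact (hΦ.dominatedSpace_inter hK hinv hy).le ⟨hv', interior_subset hC⟩
  obtain ⟨G, hG⟩ := (dominatedSpace C Φ y).exists_isCompl
  have finrank_le : Module.finrank ℝ G ≤ k := by
    by_contra! hlt
    obtain ⟨u, huG, hu0, hu⟩ := hΦ.exists_mem_dominatedSpace_of_lt_finrank hK hinv hy hlt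
    exact hu0 (Submodule.disjoint_def.1 hG.disjoint u hu huG)
  refine (Submodule.isCompl_iff_disjoint _ _ ?_).2 disjoint
  have := Submodule.finrank_add_eq_of_isCompl hG
  have := hΦ.finrank_dominantSpace hK hinv hy
  omega

end Bundles

section Separation

variable {V : Type*} [NormedAddCommGroup V] [NormedSpace ℝ V] {k : ℕ} {C : Set V} {Φ : Flow ℝ V}
  {K : Set V} {E F : V → Submodule ℝ V}

theorem IsKCone.mul_norm_le_norm_add (hC : IsKCone k C) {L N : Submodule ℝ V} {η : ℝ}
    (margin : ∀ v ∈ L, ∀ w, ‖w‖ ≤ η * ‖v‖ → v + w ∈ C) (hN : (N : Set V) ∩ C = {0}) {v w : V}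
    (hv : v ∈ L) (hw : w ∈ N) (hη : η ≤ 1) : η * ‖v‖ ≤ ‖v + w‖ := by
  by_contra! hlt
  have neg_mem : v + -(v + w) ∈ C := margin v hv _ (by rw [norm_neg]; exact hlt.le)
  have hwC : w ∈ C := by simpa using hC.smul_mem _ neg_mem (-1)
  obtain rfl : w = 0 := hN.le ⟨hw, hwC⟩
  rw [add_zero] at hlt
  nlinarith [norm_nonneg v]

variable [FiniteDimensional ℝ V]

theorem FWW.exists_add_mem_of_norm_le (hΦ : FWW k C Φ) (hK : IsCompact K) (hinv : IsInvariant Φ K)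
    (hE : ∀ y ∈ K, ∀ v ∈ E y, flowDeriv Φ (-1) y v ∈ C) :
    ∃ η : ℝ, 0 < η ∧ ∀ y ∈ K, ∀ v ∈ E y, ∀ w, ‖w‖ ≤ η * ‖v‖ → v + w ∈ C := by
  obtain ⟨ε, hε, margin⟩ := hΦ.exists_margin hK
  refine ⟨ε, hε, fun y hy v hv w hw => ?_⟩
  rcases eq_or_ne v 0 with rfl | hv0
  · obtain rfl : w = 0 := by simpa using hw
    simpa using hΦ.isKCone.zero_mem
  have from_past := margin (Φ (-1) y) (hinv _ hy) (flowDeriv Φ (-1) y v) (hE y hy v hv)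
    (flowDeriv_ne_zero hΦ.differentiable _ _ hv0) (v + w)
  rw [flowDeriv_flowDeriv_neg hΦ.differentiable, add_sub_cancel_left] at from_past
  exact interior_subset (from_past hw)

theorem FWW.exists_mul_norm_le_norm_add (hΦ : FWW k C Φ) (hK : IsCompact K)
    (hinv : IsInvariant Φ K) (hE : ∀ y ∈ K, ∀ v ∈ E y, flowDeriv Φ (-1) y v ∈ C)
    (hF : ∀ y ∈ K, (F y : Set V) ∩ C = {0}) :
    ∃ η : ℝ, 0 < η ∧
      ∀ y ∈ K, ∀ v ∈ E y, ∀ w ∈ F y, η * ‖v‖ ≤ ‖v + w‖ ∧ η * ‖w‖ ≤ ‖v + w‖ := by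
  obtain ⟨ρ, hρ, margin⟩ := hΦ.exists_add_mem_of_norm_le hK hinv hE
  have hη : 0 < min ρ 1 := by positivity
  refine ⟨min ρ 1 / 2, by positivity, fun y hy v hv w hw => ?_⟩
  have le_add : min ρ 1 * ‖v‖ ≤ ‖v + w‖ :=
    hΦ.isKCone.mul_norm_le_norm_add (fun v hv w h => margin y hy v hv w
      (h.trans (by gcongr; exact min_le_left _ _))) (hF y hy) hv hw (min_le_right _ _)
  have norm_le : ‖w‖ ≤ ‖v + w‖ + ‖v‖ := by simpa using norm_sub_le (v + w) v
  have := min_le_right ρ 1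
  constructor <;> nlinarith [norm_nonneg v, norm_nonneg w, norm_nonneg (v + w)]

theorem FWW.deriv_neg_one_mem_of_mem_dominantSpace (hΦ : FWW k C Φ) (hK : IsCompact K)
    (hinv : IsInvariant Φ K) : ∀ y ∈ K, ∀ v ∈ dominantSpace C Φ y, flowDeriv Φ (-1) y v ∈ C :=
  fun _ hy _ hv => (hΦ.mem_dominantSpace hK hinv hy).1 hv _

theorem FWW.exists_expansion (hΦ : FWW k C Φ) (hK : IsCompact K) (hinv : IsInvariant Φ K) :
    ∃ q : ℝ, 1 < q ∧ ∀ y ∈ K, ∀ v ∈ dominantSpace C Φ y, ∀ w ∈ dominatedSpace C Φ y,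
      v + w ∈ C → flowDeriv Φ 1 y v + q • flowDeriv Φ 1 y w ∈ C := by
  obtain ⟨η, hη, angle⟩ := hΦ.exists_mul_norm_le_norm_add hK hinv
    (hΦ.deriv_neg_one_mem_of_mem_dominantSpace hK hinv) fun y => hΦ.dominatedSpace_inter hK hinv
  obtain ⟨ε, hε, margin⟩ := hΦ.exists_margin hK
  refine ⟨1 + ε * η, by linarith [mul_pos hε hη], fun y hy v hv w hw hvw => ?_⟩
  rcases eq_or_ne (v + w) 0 with h0 | h0
  · obtain rfl : w = 0 := Submodule.disjoint_def.1
      (hΦ.isCompl_dominantSpace hK hinv hy).disjoint w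
      (by rw [← neg_eq_of_add_eq_zero_right h0]; exact neg_mem hv) hw
    simpa [show v = 0 by simpa using h0] using hΦ.isKCone.zero_mem
  refine interior_subset (margin y hy _ hvw h0 _ ?_)
  have image_angle := (angle _ (hinv 1 hy) _ (hΦ.deriv_mem_dominantSpace hK hinv hy hv 1) _
    (hΦ.deriv_mem_dominatedSpace hK hinv hy hw zero_le_one)).2
  calc ‖flowDeriv Φ 1 y v + (1 + ε * η) • flowDeriv Φ 1 y w - flowDeriv Φ 1 y (v + w)‖
      = ‖(ε * η) • flowDeriv Φ 1 y w‖ := by congr 1; rw [map_add]; module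
    _ = ε * (η * ‖flowDeriv Φ 1 y w‖) := by
      rw [norm_smul, Real.norm_of_nonneg (by positivity), mul_assoc]
    _ ≤ ε * ‖flowDeriv Φ 1 y (v + w)‖ := by rw [map_add]; gcongr

theorem FWW.deriv_add_pow_smul_mem (hΦ : FWW k C Φ) (hK : IsCompact K) (hinv : IsInvariant Φ K)
    {q : ℝ} (expansion : ∀ y ∈ K, ∀ v ∈ dominantSpace C Φ y, ∀ w ∈ dominatedSpace C Φ y,
      v + w ∈ C → flowDeriv Φ 1 y v + q • flowDeriv Φ 1 y w ∈ C) {y v w : V} (hy : y ∈ K)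
    (hv : v ∈ dominantSpace C Φ y) (hw : w ∈ dominatedSpace C Φ y) (hvw : v + w ∈ C) (n : ℕ) :
    flowDeriv Φ n y v + q ^ n • flowDeriv Φ n y w ∈ C := by
  induction n with
  | zero => simpa [flowDeriv_zero] using hvw
  | succ n ih =>
    have next := expansion _ (hinv n hy) _ (hΦ.deriv_mem_dominantSpace hK hinv hy hv n) _
      ((dominatedSpace C Φ _).smul_mem (q ^ n)
        (hΦ.deriv_mem_dominatedSpace hK hinv hy hw n.cast_nonneg)) ih
    rwa [map_smul, smul_smul, ← pow_succ', ← flowDeriv_add hΦ.differentiable,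
      ← flowDeriv_add hΦ.differentiable, add_comm 1 (n : ℝ), ← Nat.cast_succ] at next

theorem FWW.exists_mul_norm_le_of_add_mem (hΦ : FWW k C Φ) (hK : IsCompact K)
    (hinv : IsInvariant Φ K) :
    ∃ ε : ℝ, 0 < ε ∧ ∀ y ∈ K, ∀ w ∈ dominatedSpace C Φ y, ∀ v, v + w ∈ C → ε * ‖w‖ ≤ ‖v‖ := by
  obtain ⟨ε, hε, margin⟩ := hΦ.exists_margin_complCone hK
  refine ⟨ε, hε, fun y hy w hw v hvw => ?_⟩
  by_contra! hlt
  have hw0 : w ≠ 0 := by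
    rintro rfl
    exact (norm_nonneg v).not_gt (by simpa using hlt)
  have from_future := margin (Φ 1 y) (hinv 1 hy) _
    ((hΦ.mem_dominatedSpace hK hinv hy).1 hw 1 zero_le_one)
    (flowDeriv_ne_zero hΦ.differentiable _ _ hw0) (v + w)
  rw [flowDeriv_neg_flowDeriv hΦ.differentiable, add_sub_cancel_right] at from_future
  exact from_future hlt.le hvw

theorem FWW.exists_domination (hΦ : FWW k C Φ) (hK : IsCompact K) (hinv : IsInvariant Φ K) :
    ∃ M γ : ℝ, 0 < M ∧ 0 < γ ∧ γ < 1 ∧ ∀ y ∈ K, ∀ w ∈ dominatedSpace C Φ y, ‖w‖ = 1 →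
      ∀ v ∈ dominantSpace C Φ y, ‖v‖ = 1 → ∀ t : ℝ, 0 ≤ t →
        ‖flowDeriv Φ t y w‖ ≤ M * γ ^ t * ‖flowDeriv Φ t y v‖ := by
  obtain ⟨η, hη, near_mem⟩ := hΦ.exists_add_mem_of_norm_le hK hinv
    (hΦ.deriv_neg_one_mem_of_mem_dominantSpace hK hinv)
  obtain ⟨q, hq, expansion⟩ := hΦ.exists_expansion hK hinv
  obtain ⟨ε, hε, norm_le⟩ := hΦ.exists_mul_norm_le_of_add_mem hK hinv
  refine ⟨q / (ε * η), q⁻¹, by positivity, by positivity, inv_lt_one_of_one_lt₀ hq,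
    fun y hy w hw hw1 v hv hv1 t ht => ?_⟩
  have start : v + η • w ∈ C :=
    near_mem y hy v hv _ (by rw [norm_smul, hv1, hw1, Real.norm_of_nonneg hη.le])
  have floor_mem := hΦ.deriv_add_pow_smul_mem hK hinv expansion hy hv
    (Submodule.smul_mem _ η hw) start ⌊t⌋₊
  rw [← map_smul, ← map_add] at floor_mem
  have time_mem := hΦ.deriv_mem_of_le (Nat.floor_le ht) floor_mem
  rw [smul_smul, map_add, map_smul] at time_mem
  have bound := norm_le _ (hinv t hy) _ (Submodule.smul_mem _ (q ^ ⌊t⌋₊ * η)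
    (hΦ.deriv_mem_dominatedSpace hK hinv hy hw ht)) _ time_mem
  rw [norm_smul, Real.norm_of_nonneg (by positivity)] at bound
  have rpow_le : q ^ t ≤ q * q ^ ⌊t⌋₊ := by
    rw [← pow_succ', ← Real.rpow_natCast]
    exact Real.rpow_le_rpow_of_exponent_le hq.le (by exact_mod_cast (Nat.lt_floor_add_one t).le)
  rw [Real.inv_rpow (by positivity)]
  have : 0 < q ^ t := by positivity
  calc ‖flowDeriv Φ t y w‖
      = (ε * η)⁻¹ * (q ^ t)⁻¹ * (ε * (q ^ t * η * ‖flowDeriv Φ t y w‖)) := by field_simp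
    _ ≤ (ε * η)⁻¹ * (q ^ t)⁻¹ * (ε * (q * q ^ ⌊t⌋₊ * η * ‖flowDeriv Φ t y w‖)) := by gcongr
    _ = q / (ε * η) * (q ^ t)⁻¹ * (ε * (q ^ ⌊t⌋₊ * η * ‖flowDeriv Φ t y w‖)) := by ring
    _ ≤ q / (ε * η) * (q ^ t)⁻¹ * ‖flowDeriv Φ t y v‖ := by gcongr

theorem FWW.isContinuousBundle_dominantSpace (hΦ : FWW k C Φ) (hK : IsCompact K)
    (hinv : IsInvariant Φ K) : IsContinuousBundle K k (dominantSpace C Φ) := by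
  refine isContinuousBundle_of_isClosed (fun y => hΦ.finrank_dominantSpace hK hinv)
    (Γ := ⋂ t : ℝ, {p | flowDeriv Φ t p.1 p.2 ∈ C}) (isClosed_iInter fun t => ?_)
    fun y hy v => by rw [hΦ.mem_dominantSpace hK hinv hy, mem_iInter]; rfl
  exact hΦ.isKCone.isClosed.preimage (((continuous_flowDeriv hΦ.contDiff).comp
    (continuous_const.prodMk continuous_fst)).clm_apply continuous_snd)

theorem FWW.isContinuousBundle_dominatedSpace (hΦ : FWW k C Φ) (hK : IsCompact K)
    (hinv : IsInvariant Φ K) :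
    IsContinuousBundle K (Module.finrank ℝ V - k) (dominatedSpace C Φ) := by
  have finrank_eq : ∀ y ∈ K, Module.finrank ℝ (dominatedSpace C Φ y) = Module.finrank ℝ V - k :=
    fun y hy => by
      have := Submodule.finrank_add_eq_of_isCompl (hΦ.isCompl_dominantSpace hK hinv hy)
      have := hΦ.finrank_dominantSpace hK hinv hy
      omega
  refine isContinuousBundle_of_isClosed finrank_eq
    (Γ := ⋂ t : ℝ, ⋂ _ : 0 ≤ t, {p | flowDeriv Φ t p.1 p.2 ∈ complCone C})
    (isClosed_iInter fun t => isClosed_iInter fun _ => ?_)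
    fun y hy v => by rw [hΦ.mem_dominatedSpace hK hinv hy, mem_iInter₂]; rfl
  exact isClosed_complCone.preimage (((continuous_flowDeriv hΦ.contDiff).comp
    (continuous_const.prodMk continuous_fst)).clm_apply continuous_snd)

theorem FWW.isExpSeparation (hΦ : FWW k C Φ) (hK : IsCompact K) (hinv : IsInvariant Φ K) :
    IsExpSeparation k C Φ K (dominantSpace C Φ) (dominatedSpace C Φ) where
  bundle_E := hΦ.isContinuousBundle_dominantSpace hK hinv
  bundle_F := hΦ.isContinuousBundle_dominatedSpace hK hinv
  isCompl _ := hΦ.isCompl_dominantSpace hK hinv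
  map_E _ hy t _ := hΦ.map_dominantSpace hK hinv hy t
  map_F _ hy _ ht := Submodule.map_le_iff_le_comap.2 fun _ hv =>
    hΦ.deriv_mem_dominatedSpace hK hinv hy hv ht.le
  separation := hΦ.exists_domination hK hinv
  E_subset _ := hΦ.dominantSpace_subset hK hinv
  F_inter _ := hΦ.dominatedSpace_inter hK hinv

end Separation

section Taylor

variable {V : Type*} [NormedAddCommGroup V] [NormedSpace ℝ V] {Φ : Flow ℝ V}

theorem norm_flowDeriv_sub_le (hΦ : ContDiff ℝ 1 fun p : ℝ × V => Φ p.1 p.2) (t : ℝ) (y z : V) :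
    ‖flowDeriv Φ t y - flowDeriv Φ t z‖ ≤
      ‖fderiv ℝ (fun p : ℝ × V => Φ p.1 p.2) (t, y) -
        fderiv ℝ (fun p : ℝ × V => Φ p.1 p.2) (t, z)‖ := by
  have space_part (x : V) : flowDeriv Φ t x =
      (fderiv ℝ (fun p : ℝ × V => Φ p.1 p.2) (t, x)).comp (.inr ℝ ℝ V) :=
    (((hΦ.differentiable one_ne_zero (t, x)).hasFDerivAt).comp x
      (hasFDerivAt_prodMk_right t x)).fderiv
  rw [space_part, space_part, ← ContinuousLinearMap.sub_comp]
  exact (ContinuousLinearMap.opNorm_comp_le _ _).trans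
    (mul_le_of_le_one_right (norm_nonneg _) (ContinuousLinearMap.norm_inr_le_one ℝ ℝ V))

theorem norm_flow_add_sub_sub_le (hΦ : ∀ t, Differentiable ℝ (Φ t)) {t B : ℝ} {z d : V}
    (bound : ∀ ξ ∈ Metric.closedBall z ‖d‖, ‖flowDeriv Φ t ξ - flowDeriv Φ t z‖ ≤ B) :
    ‖Φ t (z + d) - Φ t z - flowDeriv Φ t z d‖ ≤ B * ‖d‖ := by
  simpa using (convex_closedBall z ‖d‖).norm_image_sub_le_of_norm_hasFDerivWithin_le'
    (fun ξ _ => (hΦ t ξ).hasFDerivAt.hasFDerivWithinAt) bound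
    (Metric.mem_closedBall_self (norm_nonneg d)) (y := z + d) (by simp)

theorem IsC1Holder.exists_remainder_bound_near {α : ℝ≥0} (h : IsC1Holder α Φ) (t : ℝ) (z₀ : V) :
    ∃ r L : ℝ, 0 < r ∧ 0 ≤ L ∧ ∀ z ∈ Metric.ball z₀ r, ∀ d : V, ‖d‖ ≤ r →
      ‖Φ t (z + d) - Φ t z - flowDeriv Φ t z d‖ ≤ L * ‖d‖ ^ (α : ℝ) * ‖d‖ := by
  obtain ⟨U, hU, L, holder⟩ := h.2 (t, z₀)
  obtain ⟨ρ, hρ, ball_subset⟩ := Metric.mem_nhds_iff.1 hU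
  refine ⟨ρ / 2, L, by positivity, L.2, fun z hz d hd =>
    norm_flow_add_sub_sub_le (differentiable_flow h.1) fun ξ hξ => ?_⟩
  rw [Metric.mem_closedBall] at hξ
  rw [Metric.mem_ball] at hz
  have mem_U {p : V} (hp : dist p z₀ < ρ) : (t, p) ∈ U :=
    ball_subset (by rwa [Metric.mem_ball, dist_prod_same_left])
  have hξU := mem_U ((dist_triangle ξ z z₀).trans_lt (by linarith))
  refine (norm_flowDeriv_sub_le h.1 t ξ z).trans ?_
  rw [← dist_eq_norm]
  refine (holder.dist_le hξU (mem_U (by linarith))).trans ?_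
  rw [dist_prod_same_left]
  gcongr

theorem IsC1Holder.exists_remainder_bound {α : ℝ≥0} (h : IsC1Holder α Φ) (t : ℝ) {K : Set V}
    (hK : IsCompact K) :
    ∃ r L : ℝ, 0 < r ∧ 0 ≤ L ∧ ∀ z ∈ K, ∀ d : V, ‖d‖ ≤ r →
      ‖Φ t (z + d) - Φ t z - flowDeriv Φ t z d‖ ≤ L * ‖d‖ ^ (α : ℝ) * ‖d‖ := by
  refine IsCompact.induction_on hK ?_ ?_ ?_ ?_
  · exact ⟨1, 0, one_pos, le_rfl, fun z hz => hz.elim⟩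
  · rintro S T hST ⟨r, L, hr, hL, bound⟩
    exact ⟨r, L, hr, hL, fun z hz => bound z (hST hz)⟩
  · rintro S T ⟨r, L, hr, hL, boundS⟩ ⟨r', L', hr', -, boundT⟩
    refine ⟨min r r', max L L', lt_min hr hr', le_max_of_le_left hL, fun z hz d hd => ?_⟩
    rcases hz with hz | hz
    · exact (boundS z hz d (hd.trans (min_le_left _ _))).trans (by gcongr; exact le_max_left _ _)
    · exact (boundT z hz d (hd.trans (min_le_right _ _))).trans (by gcongr; exact le_max_right _ _)
  · intro z₀ _
    obtain ⟨r, L, hr, hL, bound⟩ := h.exists_remainder_bound_near t z₀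
    exact ⟨_, nhdsWithin_le_nhds (Metric.ball_mem_nhds z₀ hr), r, L, hr, hL, bound⟩

end Taylor

section Bootstrap

variable {g a s : ℕ → ℝ} {M c D δ α ρ : ℝ}

theorem summable_rpow_of_eventually_le_pow (hg : ∀ n, 0 ≤ g n) (hα : 0 < α) (hρ : 0 < ρ)
    (hρ1 : ρ < 1) (hgρ : ∀ᶠ n in atTop, g n ≤ ρ ^ n) : Summable fun n => g n ^ α := by
  have geometric : Summable fun n : ℕ => (ρ ^ α) ^ n :=
    summable_geometric_of_lt_one (by positivity) (Real.rpow_lt_one hρ.le hρ1 hα)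
  refine geometric.of_norm_bounded_eventually_nat ?_
  filter_upwards [hgρ] with n hn
  rw [Real.norm_of_nonneg (Real.rpow_nonneg (hg n) _)]
  calc g n ^ α ≤ (ρ ^ n) ^ α := Real.rpow_le_rpow (hg n) hn hα.le
    _ = (ρ ^ α) ^ n := (Real.rpow_pow_comm hρ.le α n).symm

/-- The bootstrap: as long as `a j ≤ b * g j`, the superlinear sources `s j` contribute at most
half of the budget `b`. -/
theorem forall_le_mul_of_superlinear_source {b S : ℝ} (hg : ∀ n, 0 < g n) (hM : 0 ≤ M) (hc : 0 < c)
    (hD : 0 ≤ D) (hα : 0 ≤ α) (hb : 0 ≤ b) (hgc : ∀ n, c * g n ≤ g (n + 1))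
    (hS : ∀ n, ∑ j ∈ Finset.range n, g j ^ α ≤ S) (hbδ : ∀ n, b * g n ≤ δ)
    (small : M * (D / c * S * b ^ α) ≤ 1 / 2) (ha : ∀ n, 0 ≤ a n) (start : M * (a 0 / g 0) ≤ b / 2)
    (growth : ∀ n, a n ≤ M * g n * (a 0 / g 0 + ∑ j ∈ Finset.range n, s j / g (j + 1)))
    (source : ∀ j, a j ≤ δ → s j ≤ D * a j ^ α * a j) (n : ℕ) : a n ≤ b * g n := by
  induction n using Nat.strong_induction_on with
  | _ n ih =>
    have source_le : ∀ j ∈ Finset.range n, s j / g (j + 1) ≤ D / c * b ^ α * b * g j ^ α := by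
      intro j hj
      have hgj := hg j
      have haj := ih j (Finset.mem_range.1 hj)
      calc s j / g (j + 1) ≤ D * (b * g j) ^ α * (b * g j) / (c * g j) := by
            have := ha j
            have := hgc j
            gcongr
            exact (source j (haj.trans (hbδ j))).trans (by gcongr)
        _ = D / c * b ^ α * b * g j ^ α := by
            rw [Real.mul_rpow hb hgj.le]
            field_simp
    have sum_le : ∑ j ∈ Finset.range n, s j / g (j + 1) ≤ D / c * b ^ α * b * S := by
      refine (Finset.sum_le_sum source_le).trans ?_
      rw [← Finset.mul_sum]
      gcongr
      exact hS n
    have hgn := hg n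
    calc a n ≤ M * g n * (a 0 / g 0 + D / c * b ^ α * b * S) := (growth n).trans (by gcongr)
      _ = g n * (M * (a 0 / g 0) + M * (D / c * S * b ^ α) * b) := by ring
      _ ≤ g n * (b / 2 + 1 / 2 * b) := by gcongr
      _ = b * g n := by ring

theorem exists_pos_forall_tendsto_zero_of_superlinear_source (hg : ∀ n, 0 < g n) (hM : 0 < M)
    (hc : 0 < c) (hD : 0 ≤ D) (hα : 0 < α) (hδ : 0 < δ) (hρ : 0 < ρ) (hρ1 : ρ < 1)
    (hgc : ∀ n, c * g n ≤ g (n + 1)) (hgρ : ∀ᶠ n in atTop, g n ≤ ρ ^ n) :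
    ∃ κ : ℝ, 0 < κ ∧ ∀ a s : ℕ → ℝ, (∀ n, 0 ≤ a n) → a 0 ≤ κ →
      (∀ n, a n ≤ M * g n * (a 0 / g 0 + ∑ j ∈ Finset.range n, s j / g (j + 1))) →
      (∀ j, a j ≤ δ → s j ≤ D * a j ^ α * a j) → Tendsto a atTop (𝓝 0) := by
  have g_tendsto : Tendsto g atTop (𝓝 0) :=
    squeeze_zero' (Eventually.of_forall fun n => (hg n).le) hgρ
      (tendsto_pow_atTop_nhds_zero_of_lt_one hρ.le hρ1)
  obtain ⟨G, hG⟩ := g_tendsto.bddAbove_range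
  have summable := summable_rpow_of_eventually_le_pow (fun n => (hg n).le) hα hρ hρ1 hgρ
  have budget_small : ∀ᶠ b : ℝ in 𝓝 0,
      b * G < δ ∧ M * (D / c * (∑' n, g n ^ α) * b ^ α) < 1 / 2 := by
    have rpow_cont := Real.continuousAt_rpow_const 0 α (Or.inr hα.le)
    refine ((continuous_mul_const G).continuousAt.eventually_lt_const (by simpa using hδ)).and
      (((rpow_cont.const_mul _).const_mul _).eventually_lt_const ?_)
    simp [Real.zero_rpow hα.ne']
  obtain ⟨b, ⟨hbG, small⟩, hb⟩ :=
    ((budget_small.filter_mono nhdsWithin_le_nhds).and self_mem_nhdsWithin).exists (f := 𝓝[>] 0)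
  have hg0 := hg 0
  refine ⟨g 0 * b / (2 * M), by positivity, fun a s ha ha0 growth source => ?_⟩
  refine squeeze_zero ha (forall_le_mul_of_superlinear_source hg hM.le hc hD hα.le hb.le hgc
    (fun n => summable.sum_le_tsum _ fun j _ => Real.rpow_nonneg (hg j).le _)
    (fun n => le_trans ?_ hbG.le) small.le ha ?_ growth source)
    (by simpa using g_tendsto.const_mul b)
  · gcongr
    exact hG (mem_range_self n)
  · calc M * (a 0 / g 0) ≤ M * (g 0 * b / (2 * M) / g 0) := by gcongr
      _ = b / 2 := by field_simp

end Bootstrap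

section InfNorm

variable {V : Type*} [NormedAddCommGroup V] [NormedSpace ℝ V] {L : Submodule ℝ V}

theorem infNorm_mul_norm_le (A : V →L[ℝ] V) {u : V} (hu : u ∈ L) :
    infNorm A L * ‖u‖ ≤ ‖A u‖ := by
  rcases eq_or_ne u 0 with rfl | hu0
  · simp
  have bddBelow : BddBelow ((fun v => ‖A v‖) '' ((L : Set V) ∩ Metric.sphere 0 1)) :=
    ⟨0, forall_mem_image.2 fun v _ => norm_nonneg (A v)⟩
  have le_unit : infNorm A L ≤ ‖A (‖u‖⁻¹ • u)‖ :=
    csInf_le bddBelow ⟨_, ⟨L.smul_mem _ hu, by simp [norm_smul, hu0]⟩, rfl⟩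
  rwa [map_smul, norm_smul, norm_inv, norm_norm, le_inv_mul_iff₀ (norm_pos_iff.2 hu0),
    mul_comm] at le_unit

theorem exists_infNorm_eq [FiniteDimensional ℝ V] (A : V →L[ℝ] V) (hL : L ≠ ⊥) :
    ∃ v ∈ L, ‖v‖ = 1 ∧ infNorm A L = ‖A v‖ := by
  have isCompact : IsCompact ((L : Set V) ∩ Metric.sphere 0 1) :=
    (isCompact_sphere 0 1).inter_left (Submodule.closed_of_finiteDimensional L)
  obtain ⟨u, hu, hu0⟩ := L.exists_mem_ne_zero_of_ne_bot hL
  obtain ⟨v, ⟨hvL, hv1⟩, hv⟩ := isCompact.exists_sInf_image_eq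
    ⟨‖u‖⁻¹ • u, L.smul_mem _ hu, by simp [norm_smul, hu0]⟩ (f := fun v => ‖A v‖) (by fun_prop)
  exact ⟨v, hvL, mem_sphere_zero_iff_norm.1 hv1, hv⟩

theorem infNorm_flowDeriv_pos [FiniteDimensional ℝ V] {Φ : Flow ℝ V}
    (hΦ : ∀ t, Differentiable ℝ (Φ t)) (t : ℝ) (y : V) (hL : L ≠ ⊥) :
    0 < infNorm (flowDeriv Φ t y) L := by
  obtain ⟨v, -, hv1, hv⟩ := exists_infNorm_eq (flowDeriv Φ t y) hL
  rw [hv, norm_pos_iff]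
  exact flowDeriv_ne_zero hΦ _ _ (norm_ne_zero_iff.1 (by rw [hv1]; exact one_ne_zero))

end InfNorm

theorem flow_natCast_succ {X : Type*} [TopologicalSpace X] (Φ : Flow ℝ X) (n : ℕ) (y : X) :
    Φ ((n + 1 : ℕ) : ℝ) y = Φ 1 (Φ n y) := by
  rw [← Φ.map_add, Nat.cast_succ, add_comm]

section Weight

variable {V : Type*} [NormedAddCommGroup V] [NormedSpace ℝ V] {Φ : Flow ℝ V}

/-- The weight `γ ^ n * m(D_z Φ_n | L)`. When `L` is the dominant fibre at `z` of an exponential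
separation with rate `γ`, its quotients bound the growth of the derivative on the dominated bundle
along the orbit of `z`. -/
noncomputable def growthWeight (γ : ℝ) (Φ : Flow ℝ V) (z : V) (L : Submodule ℝ V) (n : ℕ) : ℝ :=
  γ ^ n * infNorm (flowDeriv Φ n z) L

variable {γ : ℝ} {z : V}

theorem mul_growthWeight_le [FiniteDimensional ℝ V] (hΦ : ∀ t, Differentiable ℝ (Φ t))
    {L : Submodule ℝ V} (hL : L ≠ ⊥) (hγ : 0 ≤ γ) {c : ℝ} (hc : 0 ≤ c) (n : ℕ)
    (bound : ∀ v, c * ‖v‖ ≤ ‖flowDeriv Φ 1 (Φ n z) v‖) :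
    c * γ * growthWeight γ Φ z L n ≤ growthWeight γ Φ z L (n + 1) := by
  obtain ⟨v, hvL, hv1, hv⟩ := exists_infNorm_eq (flowDeriv Φ ((n + 1 : ℕ) : ℝ) z) hL
  have infNorm_le : c * infNorm (flowDeriv Φ n z) L ≤
      infNorm (flowDeriv Φ ((n + 1 : ℕ) : ℝ) z) L := by
    have := infNorm_mul_norm_le (flowDeriv Φ n z) hvL
    rw [hv1, mul_one] at this
    rw [hv, Nat.cast_succ, add_comm, flowDeriv_add hΦ]
    exact (mul_le_mul_of_nonneg_left this hc).trans (bound _)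
  calc c * γ * (γ ^ n * infNorm (flowDeriv Φ n z) L)
      = γ ^ (n + 1) * (c * infNorm (flowDeriv Φ n z) L) := by ring
    _ ≤ γ ^ (n + 1) * infNorm (flowDeriv Φ ((n + 1 : ℕ) : ℝ) z) L := by gcongr

theorem eventually_growthWeight_le_pow {E : V → Submodule ℝ V} (hγ : 0 < γ) (hγ1 : γ < 1)
    (pos : ∀ n : ℕ, 0 < infNorm (flowDeriv Φ n z) (E z)) (hlyap : lyapunovExponent Φ E z ≤ 0) :
    ∀ᶠ n in atTop, growthWeight γ Φ z (E z) n ≤ √γ ^ n := by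
  have log_neg := Real.log_neg hγ hγ1
  have limsup_lt : limsup (lyapunovQuotient Φ E z) atTop < ((-Real.log γ / 2 : ℝ) : EReal) :=
    hlyap.trans_lt (by exact_mod_cast (by linarith : (0 : ℝ) < -Real.log γ / 2))
  filter_upwards [tendsto_natCast_atTop_atTop.eventually (eventually_lt_of_limsup_lt limsup_lt),
    eventually_gt_atTop 0] with n hn hn0
  have hposn := pos n
  rw [lyapunovQuotient, EReal.coe_lt_coe_iff, div_lt_iff₀ (Nat.cast_pos.2 hn0)] at hn
  rw [growthWeight, ← Real.log_le_log_iff (by positivity) (by positivity),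
    Real.log_mul (by positivity) hposn.ne', Real.log_pow, Real.log_pow, Real.log_sqrt hγ.le]
  linarith

end Weight

section LocalAlternative

variable {V : Type*} [NormedAddCommGroup V] [NormedSpace ℝ V] {k : ℕ} {C : Set V} {Φ : Flow ℝ V}
  {K : Set V} {E F : V → Submodule ℝ V}

theorem IsExpSeparation.deriv_mem_E (hs : IsExpSeparation k C Φ K E F) {y v : V} (hy : y ∈ K)
    (hv : v ∈ E y) {t : ℝ} (ht : 0 ≤ t) : flowDeriv Φ t y v ∈ E (Φ t y) := by
  rcases ht.eq_or_lt with rfl | ht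
  · rwa [flowDeriv_zero, Φ.map_zero_apply]
  · rw [← hs.map_E y hy t ht]
    exact ⟨v, hv, rfl⟩

theorem IsExpSeparation.deriv_mem_F (hs : IsExpSeparation k C Φ K E F) {y v : V} (hy : y ∈ K)
    (hv : v ∈ F y) {t : ℝ} (ht : 0 ≤ t) : flowDeriv Φ t y v ∈ F (Φ t y) := by
  rcases ht.eq_or_lt with rfl | ht
  · rwa [flowDeriv_zero, Φ.map_zero_apply]
  · exact hs.map_F y hy t ht ⟨v, hv, rfl⟩

theorem IsExpSeparation.deriv_neg_one_mem (hs : IsExpSeparation k C Φ K E F) (hΦ : FWW k C Φ)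
    (hinv : IsInvariant Φ K) : ∀ y ∈ K, ∀ v ∈ E y, flowDeriv Φ (-1) y v ∈ C := by
  intro y hy v hv
  have map_E := hs.map_E _ (hinv (-1) hy) 1 one_pos
  rw [flow_flow_neg] at map_E
  obtain ⟨u, hu, rfl⟩ := map_E.ge hv
  have pullback := flowDeriv_neg_flowDeriv hΦ.differentiable 1 (Φ (-1) y) u
  rw [flow_flow_neg] at pullback
  rw [ContinuousLinearMap.coe_coe, pullback]
  rcases hs.E_subset _ (hinv (-1) hy) hu with hu | rfl
  · exact interior_subset hu
  · exact hΦ.isKCone.zero_mem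

theorem IsExpSeparation.exists_dominated (hs : IsExpSeparation k C Φ K E F) :
    ∃ M γ : ℝ, 0 < M ∧ 0 < γ ∧ γ < 1 ∧ ∀ y ∈ K, ∀ w ∈ F y, ∀ v ∈ E y, ∀ t : ℝ, 0 ≤ t →
      ‖flowDeriv Φ t y w‖ * ‖v‖ ≤ M * γ ^ t * ‖flowDeriv Φ t y v‖ * ‖w‖ := by
  obtain ⟨M, γ, hM, hγ, hγ1, separation⟩ := hs.separation
  refine ⟨M, γ, hM, hγ, hγ1, fun y hy w hw v hv t ht => ?_⟩
  rcases eq_or_ne w 0 with rfl | hw0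
  · simp
  rcases eq_or_ne v 0 with rfl | hv0
  · simp
  have normalized := separation y hy (‖w‖⁻¹ • w) ((F y).smul_mem _ hw) (by simp [norm_smul, hw0])
    (‖v‖⁻¹ • v) ((E y).smul_mem _ hv) (by simp [norm_smul, hv0]) t ht
  rw [map_smul, map_smul, norm_smul, norm_smul, norm_inv, norm_inv, norm_norm, norm_norm]
    at normalized
  calc ‖flowDeriv Φ t y w‖ * ‖v‖
      = ‖w‖⁻¹ * ‖flowDeriv Φ t y w‖ * (‖v‖ * ‖w‖) := by field_simp
    _ ≤ M * γ ^ t * (‖v‖⁻¹ * ‖flowDeriv Φ t y v‖) * (‖v‖ * ‖w‖) := by gcongr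
    _ = _ := by field_simp

/-- The projection onto the dominated fibre `F y` along the dominant fibre `E y`. -/
noncomputable def IsExpSeparation.dominatedProj (hs : IsExpSeparation k C Φ K E F) {y : V}
    (hy : y ∈ K) : V →ₗ[ℝ] V :=
  (F y).projection (E y) (hs.isCompl y hy).symm

theorem IsExpSeparation.dominatedProj_mem (hs : IsExpSeparation k C Φ K E F) {y : V} (hy : y ∈ K)
    (v : V) : hs.dominatedProj hy v ∈ F y :=
  Submodule.projection_apply_mem _ _

theorem IsExpSeparation.sub_dominatedProj_mem (hs : IsExpSeparation k C Φ K E F) {y : V}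
    (hy : y ∈ K) (v : V) : v - hs.dominatedProj hy v ∈ E y :=
  Submodule.sub_projection_mem _ _

theorem IsExpSeparation.dominatedProj_flowDeriv (hs : IsExpSeparation k C Φ K E F) {t : ℝ}
    (ht : 0 ≤ t) {y y' : V} (hy : y ∈ K) (hy' : y' ∈ K) (h : Φ t y = y') (v : V) :
    hs.dominatedProj hy' (flowDeriv Φ t y v) = flowDeriv Φ t y (hs.dominatedProj hy v) := by
  subst h
  have proj_F : hs.dominatedProj hy' (flowDeriv Φ t y (hs.dominatedProj hy v)) =
      flowDeriv Φ t y (hs.dominatedProj hy v) :=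
    Submodule.projection_apply_of_mem_left _ (hs.deriv_mem_F hy (hs.dominatedProj_mem hy v) ht)
  have proj_E : hs.dominatedProj hy' (flowDeriv Φ t y (v - hs.dominatedProj hy v)) = 0 :=
    Submodule.projection_apply_of_mem_right _
      (hs.deriv_mem_E hy (hs.sub_dominatedProj_mem hy v) ht)
  rwa [map_sub, map_sub, proj_F, sub_eq_zero] at proj_E

theorem IsExpSeparation.exists_norm_dominatedProj_le [FiniteDimensional ℝ V]
    (hs : IsExpSeparation k C Φ K E F) (hΦ : FWW k C Φ) (hK : IsCompact K)
    (hinv : IsInvariant Φ K) :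
    ∃ B : ℝ, 0 < B ∧ ∀ y (hy : y ∈ K) (v : V), ‖hs.dominatedProj hy v‖ ≤ B * ‖v‖ ∧
      (v ∉ C → ‖v‖ ≤ B * ‖hs.dominatedProj hy v‖) := by
  obtain ⟨η, hη, angle⟩ := hΦ.exists_mul_norm_le_norm_add hK hinv (hs.deriv_neg_one_mem hΦ hinv)
    hs.F_inter
  obtain ⟨ε, hε, margin⟩ := hΦ.exists_add_mem_of_norm_le hK hinv (hs.deriv_neg_one_mem hΦ hinv)
  refine ⟨max η⁻¹ (ε⁻¹ + 1), by positivity, fun y hy v => ?_⟩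
  have decomp : v - hs.dominatedProj hy v + hs.dominatedProj hy v = v := sub_add_cancel _ _
  have he := hs.sub_dominatedProj_mem hy v
  have hf := hs.dominatedProj_mem hy v
  refine ⟨?_, fun hvC => ?_⟩
  · have := (angle y hy _ he _ hf).2
    rw [decomp, ← le_inv_mul_iff₀ hη] at this
    exact this.trans (by gcongr; exact le_max_left _ _)
  · have norm_lt : ε * ‖v - hs.dominatedProj hy v‖ < ‖hs.dominatedProj hy v‖ := by
      by_contra! h
      exact hvC (decomp ▸ margin y hy _ he _ h)
    calc ‖v‖ ≤ ‖v - hs.dominatedProj hy v‖ + ‖hs.dominatedProj hy v‖ := norm_le_norm_sub_add _ _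
      _ ≤ ε⁻¹ * ‖hs.dominatedProj hy v‖ + ‖hs.dominatedProj hy v‖ := by
        gcongr
        exact (le_inv_mul_iff₀ hε).2 norm_lt.le
      _ = (ε⁻¹ + 1) * ‖hs.dominatedProj hy v‖ := by ring
      _ ≤ _ := by gcongr; exact le_max_right _ _

theorem IsExpSeparation.ne_bot (hs : IsExpSeparation k C Φ K E F) (hk : 1 ≤ k) {y : V}
    (hy : y ∈ K) : E y ≠ ⊥ := by
  intro h
  have finrank_eq := hs.bundle_E.finrank_eq y hy
  rw [h, finrank_bot] at finrank_eq
  omega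

theorem IsExpSeparation.exists_norm_flowDeriv_le_growthWeight [FiniteDimensional ℝ V]
    (hs : IsExpSeparation k C Φ K E F) (hΦ : FWW k C Φ) (hinv : IsInvariant Φ K) :
    ∃ M γ : ℝ, 0 < M ∧ 0 < γ ∧ γ < 1 ∧ ∀ z ∈ K, ∀ j i : ℕ, ∀ w ∈ F (Φ j z),
      ‖flowDeriv Φ i (Φ j z) w‖ ≤
        M * (growthWeight γ Φ z (E z) (j + i) / growthWeight γ Φ z (E z) j) * ‖w‖ := by
  obtain ⟨M, γ, hM, hγ, hγ1, dominated⟩ := hs.exists_dominated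
  refine ⟨M, γ, hM, hγ, hγ1, fun z hz j i w hw => ?_⟩
  have hE := hs.ne_bot hΦ.isKCone.one_le hz
  have pos := infNorm_flowDeriv_pos hΦ.differentiable j z hE
  obtain ⟨v, hvE, hv1, hv⟩ := exists_infNorm_eq (flowDeriv Φ ((j + i : ℕ) : ℝ) z) hE
  have dominated_v := dominated _ (hinv j hz) w hw _ (hs.deriv_mem_E hz hvE j.cast_nonneg) i
    i.cast_nonneg
  rw [← flowDeriv_add hΦ.differentiable, add_comm (i : ℝ), ← Nat.cast_add, ← hv,
    Real.rpow_natCast] at dominated_v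
  have infNorm_le := infNorm_mul_norm_le (flowDeriv Φ j z) hvE
  rw [hv1, mul_one] at infNorm_le
  calc ‖flowDeriv Φ i (Φ j z) w‖
      = ‖flowDeriv Φ i (Φ j z) w‖ * infNorm (flowDeriv Φ j z) (E z) /
          infNorm (flowDeriv Φ j z) (E z) := by field_simp
    _ ≤ M * γ ^ i * infNorm (flowDeriv Φ ((j + i : ℕ) : ℝ) z) (E z) * ‖w‖ /
          infNorm (flowDeriv Φ j z) (E z) := by
      exact div_le_div_of_nonneg_right (le_trans (by gcongr) dominated_v) pos.le
    _ = _ := by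
      rw [growthWeight, growthWeight, pow_add]
      field_simp

/-- A discrete variation of constants formula, in the form of an estimate. -/
theorem norm_flowDeriv_le_of_perturbed (hΦ : ∀ t, Differentiable ℝ (Φ t)) {z : V} {M : ℝ}
    {g : ℕ → ℝ} (growth : ∀ j i : ℕ, ∀ w ∈ F (Φ j z),
      ‖flowDeriv Φ i (Φ j z) w‖ ≤ M * (g (j + i) / g j) * ‖w‖) {f s : ℕ → V}
    (hf0 : f 0 ∈ F (Φ (0 : ℕ) z)) (hs : ∀ n : ℕ, s n ∈ F (Φ (n + 1 : ℕ) z))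
    (hf : ∀ n : ℕ, f (n + 1) = flowDeriv Φ 1 (Φ n z) (f n) + s n) (n i : ℕ) :
    ‖flowDeriv Φ i (Φ n z) (f n)‖ ≤
      M * g (n + i) * (‖f 0‖ / g 0 + ∑ j ∈ Finset.range n, ‖s j‖ / g (j + 1)) := by
  induction n generalizing i with
  | zero =>
    refine (growth 0 i _ hf0).trans_eq ?_
    rw [Finset.sum_range_zero]
    ring
  | succ n ih =>
    have split : flowDeriv Φ i (Φ ((n + 1 : ℕ) : ℝ) z) (f (n + 1)) =
        flowDeriv Φ ((i + 1 : ℕ) : ℝ) (Φ n z) (f n) +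
          flowDeriv Φ i (Φ ((n + 1 : ℕ) : ℝ) z) (s n) := by
      rw [hf, map_add, flow_natCast_succ, ← flowDeriv_add hΦ, Nat.cast_succ]
    calc ‖flowDeriv Φ i (Φ ((n + 1 : ℕ) : ℝ) z) (f (n + 1))‖
        ≤ M * g (n + (i + 1)) * (‖f 0‖ / g 0 + ∑ j ∈ Finset.range n, ‖s j‖ / g (j + 1)) +
            M * (g (n + 1 + i) / g (n + 1)) * ‖s n‖ := by
          rw [split]
          exact (norm_add_le _ _).trans (add_le_add (ih (i + 1)) (growth (n + 1) i _ (hs n)))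
      _ = _ := by
          rw [Finset.sum_range_succ, show n + (i + 1) = n + 1 + i by ring]
          ring

theorem IsExpSeparation.exists_pos_forall_tendsto_zero_of_perturbed [FiniteDimensional ℝ V]
    (hs : IsExpSeparation k C Φ K E F) (hΦ : FWW k C Φ) (hK : IsCompact K)
    (hinv : IsInvariant Φ K) {z : V} (hz : z ∈ K) (hlyap : lyapunovExponent Φ E z ≤ 0) {D δ α : ℝ}
    (hD : 0 ≤ D) (hδ : 0 < δ) (hα : 0 < α) :
    ∃ κ : ℝ, 0 < κ ∧ ∀ f s : ℕ → V, f 0 ∈ F (Φ (0 : ℕ) z) → (∀ n : ℕ, s n ∈ F (Φ (n + 1 : ℕ) z)) →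
      (∀ n : ℕ, f (n + 1) = flowDeriv Φ 1 (Φ n z) (f n) + s n) → ‖f 0‖ ≤ κ →
      (∀ n, ‖f n‖ ≤ δ → ‖s n‖ ≤ D * ‖f n‖ ^ α * ‖f n‖) → Tendsto f atTop (𝓝 0) := by
  obtain ⟨M, γ, hM, hγ, hγ1, growth⟩ := hs.exists_norm_flowDeriv_le_growthWeight hΦ hinv
  obtain ⟨c, hc, lower⟩ := exists_mul_norm_le_norm_flowDeriv hΦ.contDiff hK 1
  have hE := hs.ne_bot hΦ.isKCone.one_le hz
  have pos (n : ℕ) := infNorm_flowDeriv_pos hΦ.differentiable n z hE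
  obtain ⟨κ, hκ, bootstrap⟩ := exists_pos_forall_tendsto_zero_of_superlinear_source
    (g := growthWeight γ Φ z (E z)) (fun n => mul_pos (pow_pos hγ n) (pos n)) hM
    (mul_pos hc hγ) hD hα hδ (Real.sqrt_pos.2 hγ)
    ((Real.sqrt_lt' one_pos).2 (by rwa [one_pow]))
    (fun n => mul_growthWeight_le hΦ.differentiable hE hγ.le hc.le n (lower _ (hinv n hz)))
    (eventually_growthWeight_le_pow hγ hγ1 pos hlyap)
  refine ⟨κ, hκ, fun f s hf0 hsF hf start source => tendsto_zero_iff_norm_tendsto_zero.2 <|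
    bootstrap (fun n => ‖f n‖) (fun n => ‖s n‖) (fun n => norm_nonneg _) start (fun n => ?_)
      source⟩
  simpa [flowDeriv_zero] using
    norm_flowDeriv_le_of_perturbed hΦ.differentiable (growth z hz) hf0 hsF hf n 0

theorem IsExpSeparation.exists_local_alternative [FiniteDimensional ℝ V]
    (hs : IsExpSeparation k C Φ K E F) (hΦ : FWW k C Φ) (hK : IsCompact K)
    (hinv : IsInvariant Φ K) {z : V} (hz : z ∈ K) (hlyap : lyapunovExponent Φ E z ≤ 0) :
    ∃ r : ℝ, 0 < r ∧ ∀ y, ‖y - z‖ < r → (∀ n : ℕ, Φ n y - Φ n z ∉ C) →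
      Tendsto (fun n : ℕ => Φ n y - Φ n z) atTop (𝓝 0) := by
  obtain ⟨α, hα, -, holder⟩ := hΦ.smooth
  obtain ⟨r, L, hr, hL, remainder⟩ := holder.exists_remainder_bound 1 hK
  obtain ⟨B, hB, proj_bound⟩ := hs.exists_norm_dominatedProj_le hΦ hK hinv
  obtain ⟨κ, hκ, bootstrap⟩ := hs.exists_pos_forall_tendsto_zero_of_perturbed hΦ hK hinv hz hlyap
    (D := B * L * B ^ (α : ℝ) * B) (by positivity) (div_pos hr hB) (NNReal.coe_pos.2 hα)
  refine ⟨κ / B, by positivity, fun y hy hyC => ?_⟩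
  let d : ℕ → V := fun n => Φ n y - Φ n z
  have hzK (n : ℕ) : Φ n z ∈ K := hinv n hz
  let f : ℕ → V := fun n => hs.dominatedProj (hzK n) (d n)
  have d_le (n : ℕ) : ‖d n‖ ≤ B * ‖f n‖ := (proj_bound _ (hzK n) (d n)).2 (hyC n)
  have f_tendsto : Tendsto f atTop (𝓝 0) := by
    refine bootstrap f
      (fun n => hs.dominatedProj (hzK (n + 1)) (d (n + 1) - flowDeriv Φ 1 (Φ n z) (d n)))
      (hs.dominatedProj_mem _ _) (fun n => hs.dominatedProj_mem _ _) (fun n => ?_) ?_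
      fun n hn => ?_
    · rw [map_sub, hs.dominatedProj_flowDeriv zero_le_one (hzK n) (hzK (n + 1))
        (flow_natCast_succ Φ n z).symm, add_sub_cancel]
    · refine (proj_bound _ (hzK 0) (d 0)).1.trans ?_
      rw [← le_div_iff₀' hB]
      simpa [d] using hy.le
    · have d_small : ‖d n‖ ≤ r := (d_le n).trans ((le_div_iff₀' hB).1 hn)
      have taylor := remainder _ (hzK n) (d n) d_small
      rw [add_sub_cancel, ← flow_natCast_succ, ← flow_natCast_succ] at taylor
      calc _ ≤ B * ‖d (n + 1) - flowDeriv Φ 1 (Φ n z) (d n)‖ := (proj_bound _ (hzK _) _).1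
        _ ≤ B * (L * (B * ‖f n‖) ^ (α : ℝ) * (B * ‖f n‖)) := by
          have := d_le n
          gcongr
          exact taylor.trans (by gcongr)
        _ = _ := by
          rw [Real.mul_rpow hB.le (norm_nonneg _)]
          ring
  exact squeeze_zero_norm d_le (by simpa using f_tendsto.norm.const_mul B)

end LocalAlternative

section OmegaLimit

theorem eq_of_mapClusterPt_of_tendsto {ι X : Type*} [TopologicalSpace X] [T2Space X]
    {l : Filter ι} {f : ι → X} {p q : X} (hp : MapClusterPt p l f) (hq : Tendsto f l (𝓝 q)) :
    p = q :=
  eq_of_nhds_neBot (ClusterPt.mono hp hq)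

theorem flow_eq_self_of_eventually {X : Type*} [TopologicalSpace X] {Φ : Flow ℝ X} {z : X}
    (h : ∀ᶠ s in 𝓝 0, Φ s z = z) (t : ℝ) : Φ t z = z := by
  let _ := Φ.toAddAction
  have isOpen : IsOpen (AddAction.stabilizer ℝ z : Set ℝ) :=
    AddSubgroup.isOpen_of_mem_nhds _ (g := 0) h
  have eq_univ := IsClopen.eq_univ ⟨AddSubgroup.isClosed_of_isOpen _ isOpen, isOpen⟩ ⟨0, zero_mem _⟩
  exact eq_univ.ge (mem_univ t)

variable {V : Type*} [NormedAddCommGroup V] {Φ : Flow ℝ V} {x z : V}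

theorem isEquilibrium_iff : IsEquilibrium Φ x ↔ ∀ t : ℝ, 0 ≤ t → Φ t x = x := by
  rw [IsEquilibrium, Flow.forwardOrbit_eq_range_nonneg, eq_singleton_iff_unique_mem,
    forall_mem_range, Subtype.forall, and_iff_right ⟨⟨0, le_rfl⟩, Φ.map_zero_apply x⟩]

theorem mem_omegaSet_iff : z ∈ omegaSet Φ x ↔ MapClusterPt z atTop fun t => Φ t x :=
  mem_omegaLimit_singleton_iff_mapClusterPt ..

theorem isInvariant_omegaSet : IsInvariant Φ (omegaSet Φ x) :=
  Φ.isInvariant_omegaLimit _ _ fun t => tendsto_atTop_add_const_left _ t tendsto_id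

theorem omegaSet_flow (t : ℝ) : omegaSet Φ (Φ t x) = omegaSet Φ x := by
  rw [omegaSet, ← image_singleton]
  exact Φ.omegaLimit_image_eq _ _ (fun s => tendsto_atTop_add_const_right _ s tendsto_id) t

theorem isCompact_omegaSet [ProperSpace V] (hx : Bornology.IsBounded (Φ.forwardOrbit x)) :
    IsCompact (omegaSet Φ x) := by
  refine hx.isCompact_closure.of_isClosed_subset (isClosed_omegaLimit ..) ?_
  refine (omegaLimit_subset_closure_image2 _ _ _ (Ici_mem_atTop 0)).trans (closure_mono ?_)
  rintro _ ⟨t, ht, _, rfl, rfl⟩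
  exact ⟨⟨t, ht⟩, rfl⟩

theorem omegaSet_eq_singleton_of_tendsto (h : Tendsto (fun t => Φ t x) atTop (𝓝 z)) :
    omegaSet Φ x = {z} :=
  eq_singleton_iff_unique_mem.2 ⟨mem_omegaSet_iff.2 h.mapClusterPt, fun _ hp =>
    eq_of_mapClusterPt_of_tendsto (mem_omegaSet_iff.1 hp) h⟩

theorem IsEquilibrium.omegaSet_eq (hx : IsEquilibrium Φ x) : omegaSet Φ x = {x} :=
  omegaSet_eq_singleton_of_tendsto <| tendsto_const_nhds.congr' <|
    (eventually_ge_atTop 0).mono fun t ht => (isEquilibrium_iff.1 hx t ht).symm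

theorem tendsto_flow_sub_of_tendsto_natCast {K : Set V} (hK : IsCompact K)
    (hinv : IsInvariant Φ K) {y : V} (hz : z ∈ K)
    (h : Tendsto (fun n : ℕ => Φ n y - Φ n z) atTop (𝓝 0)) :
    Tendsto (fun t : ℝ => Φ t y - Φ t z) atTop (𝓝 0) := by
  rw [Metric.tendsto_nhds]
  intro ε hε
  obtain ⟨δ, hδ, uniform⟩ := Metric.mem_uniformity_dist.1 <|
    ((isCompact_Icc (a := (0 : ℝ)) (b := 1)).prod hK).uniformContinuousAt_of_continuousAt
      (fun p : ℝ × V => Φ p.1 p.2) (fun p _ => Φ.cont'.continuousAt)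
      (Metric.dist_mem_uniformity hε)
  filter_upwards [tendsto_nat_floor_atTop.eventually (Metric.tendsto_nhds.1 h δ hδ),
    eventually_ge_atTop 0] with t floor_close ht
  have fract_mem : t - ⌊t⌋₊ ∈ Icc (0 : ℝ) 1 :=
    ⟨sub_nonneg.2 (Nat.floor_le ht), by linarith [Nat.lt_floor_add_one t]⟩
  have split (p : V) : Φ t p = Φ (t - ⌊t⌋₊) (Φ ⌊t⌋₊ p) := by
    rw [← Φ.map_add, sub_add_cancel]
  have close := uniform (a := (t - ⌊t⌋₊, Φ ⌊t⌋₊ z)) (b := (t - ⌊t⌋₊, Φ ⌊t⌋₊ y))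
    (by rwa [Prod.dist_eq, dist_self, max_eq_right dist_nonneg, dist_comm, dist_eq_norm,
      ← dist_zero_right]) ⟨fract_mem, hinv _ hz⟩
  rwa [split y, split z, dist_zero_right, ← dist_eq_norm, dist_comm]

theorem flow_eq_self_of_tendsto {s : ℝ} (hz : z ∈ omegaSet Φ x)
    (h : Tendsto (fun t => Φ t x - Φ t z) atTop (𝓝 0))
    (hs : Tendsto (fun t => Φ t (Φ s x) - Φ t z) atTop (𝓝 0)) : Φ s z = z := by
  have displacement : Tendsto (fun t => Φ s (Φ t x) - Φ t x) atTop (𝓝 0) := by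
    rw [← sub_zero (0 : V)]
    refine (hs.sub h).congr fun t => ?_
    rw [sub_sub_sub_cancel_right, ← Φ.map_add, ← Φ.map_add, add_comm]
  have cluster : MapClusterPt (Φ s z - z) atTop fun t => Φ s (Φ t x) - Φ t x :=
    (mem_omegaSet_iff.1 hz).continuousAt_comp
      ((Φ.continuous_toFun s).sub continuous_id).continuousAt
  exact sub_eq_zero.1 (eq_of_mapClusterPt_of_tendsto cluster displacement)

theorem omegaSet_eq_singleton_of_eventually_tendsto (hz : z ∈ omegaSet Φ x)
    (h : ∀ᶠ s in 𝓝 0, Tendsto (fun t => Φ t (Φ s x) - Φ t z) atTop (𝓝 0)) :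
    omegaSet Φ x = {z} ∧ IsEquilibrium Φ z := by
  have h₀ : Tendsto (fun t => Φ t x - Φ t z) atTop (𝓝 0) := by
    simpa only [Φ.map_zero_apply] using h.self_of_nhds
  have fixed := flow_eq_self_of_eventually (h.mono fun s hs => flow_eq_self_of_tendsto hz h₀ hs)
  refine ⟨omegaSet_eq_singleton_of_tendsto ?_, isEquilibrium_iff.2 fun t _ => fixed t⟩
  simpa only [fixed, tendsto_sub_nhds_zero_iff] using h₀

end OmegaLimit

section Convergence

variable {V : Type*} [NormedAddCommGroup V] [NormedSpace ℝ V] {k : ℕ} {C : Set V} {Φ : Flow ℝ V}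
  {x z : V}

theorem FWW.flow_sub_flow_notMem (hΦ : FWW k C Φ) (hxQ : x ∉ pseudoOrderedSet C Φ)
    (hxe : ¬ IsEquilibrium Φ x) (hz : z ∈ omegaSet Φ x) {τ t : ℝ} (hτ : 0 ≤ τ) (ht : 0 ≤ t)
    (hne : Φ τ x ≠ z) : Φ t (Φ τ x) - Φ t z ∉ C := by
  intro ordered
  have injective (r : ℝ) : Function.Injective (Φ r) := (Φ.toHomeomorph r).injective
  have strongly_ordered : Φ 1 (Φ t (Φ τ x)) - Φ 1 (Φ t z) ∈ interior C :=
    hΦ.stronglyMonotone.2 _ _ ((injective t).ne hne) ordered 1 one_pos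
  have continuous : Continuous fun p => Φ 1 (Φ t (Φ τ x)) - Φ 1 (Φ t p) :=
    continuous_const.sub ((Φ.continuous_toFun 1).comp (Φ.continuous_toFun t))
  obtain ⟨s, ⟨mem, ne⟩, hs⟩ := (((mem_omegaSet_iff.1 hz).frequently
    ((continuous.continuousAt.eventually_mem (isOpen_interior.mem_nhds strongly_ordered)).and
      (isOpen_ne.mem_nhds hne.symm))).and_eventually (eventually_ge_atTop 0)).exists
  refine hxQ ⟨hxe, 1 + (t + τ), 1 + (t + s), by positivity, by positivity, ?_, ?_⟩ <;>
    simp only [Φ.map_add]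
  · exact (injective 1).ne ((injective t).ne (Ne.symm ne))
  · exact interior_subset mem

theorem FWW.omegaSet_eq_singleton_of_lyapunovExponent_nonpos [FiniteDimensional ℝ V]
    (hΦ : FWW k C Φ) (hx : Bornology.IsBounded (Φ.forwardOrbit x)) {E F : V → Submodule ℝ V}
    (hs : IsExpSeparation k C Φ (omegaSet Φ x) E F) (hz : z ∈ omegaSet Φ x)
    (hlyap : lyapunovExponent Φ E z ≤ 0) (hxQ : x ∉ pseudoOrderedSet C Φ) :
    omegaSet Φ x = {z} ∧ IsEquilibrium Φ z := by
  by_cases hxe : IsEquilibrium Φ x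
  · obtain rfl : z = x := mem_singleton_iff.1 (hxe.omegaSet_eq ▸ hz)
    exact ⟨hxe.omegaSet_eq, hxe⟩
  have := FiniteDimensional.proper_real V
  have hK := isCompact_omegaSet hx
  obtain ⟨r, hr, alternative⟩ := hs.exists_local_alternative hΦ hK isInvariant_omegaSet hz hlyap
  have asymptotic {τ : ℝ} (hτ : 0 ≤ τ) (close : ‖Φ τ x - z‖ < r) :
      Tendsto (fun t => Φ t (Φ τ x) - Φ t z) atTop (𝓝 0) := by
    by_cases hne : Φ τ x = z
    · simp [hne]
    · exact tendsto_flow_sub_of_tendsto_natCast hK isInvariant_omegaSet hz <|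
        alternative _ close fun n => hΦ.flow_sub_flow_notMem hxQ hxe hz hτ n.cast_nonneg hne
  obtain ⟨τ, close, hτ⟩ := (((mem_omegaSet_iff.1 hz).frequently
    (Metric.ball_mem_nhds z hr)).and_eventually (eventually_gt_atTop 0)).exists
  have orbit_continuous : ContinuousAt (fun s => Φ (s + τ) x) 0 :=
    (Φ.continuous (continuous_add_const τ) continuous_const).continuousAt
  rw [← omegaSet_flow τ] at hz ⊢
  refine omegaSet_eq_singleton_of_eventually_tendsto hz ?_
  filter_upwards [orbit_continuous.eventually_mem
    (by simpa using Metric.isOpen_ball.mem_nhds close), lt_mem_nhds (neg_lt_zero.2 hτ)]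
    with s hs hs₀
  rw [← Φ.map_add]
  exact asymptotic (by linarith) (by simpa [dist_eq_norm] using hs)

end Convergence

end KCone

theorem theorem4p2_general {V : Type*} [NormedAddCommGroup V] [NormedSpace ℝ V]
    [FiniteDimensional ℝ V] (k : ℕ) (C : Set V) (Φ : Flow ℝ V) (hΦ : KCone.FWW k C Φ)
    (x : V) (hx : Bornology.IsBounded (Φ.forwardOrbit x)) :
    (∃ E F : V → Submodule ℝ V, KCone.IsExpSeparation k C Φ (KCone.omegaSet Φ x) E F) ∧
    ∀ E F : V → Submodule ℝ V, KCone.IsExpSeparation k C Φ (KCone.omegaSet Φ x) E F →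
      ∀ z ∈ KCone.omegaSet Φ x, KCone.lyapunovExponent Φ E z ≤ 0 →
        x ∈ KCone.pseudoOrderedSet C Φ ∨
          (KCone.omegaSet Φ x = {z} ∧ KCone.IsEquilibrium Φ z) := by
  have := FiniteDimensional.proper_real V
  refine ⟨⟨_, _, hΦ.isExpSeparation (KCone.isCompact_omegaSet hx) KCone.isInvariant_omegaSet⟩,
    fun E F hs z hz hlyap => ?_⟩
  exact or_iff_not_imp_left.2
    (hΦ.omegaSet_eq_singleton_of_lyapunovExponent_nonpos hx hs hz hlyap)

theorem theorem4p2 {V : Type*} [NormedAddCommGroup V] [NormedSpace ℝ V] [FiniteDimensional ℝ V]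
    (k : ℕ) (C : Set V) (Φ : Flow ℝ V) (hΦ : KCone.FWW k C Φ)
    (x : V) (hx : Bornology.IsBounded (Φ.forwardOrbit x)) :
    (∃ E F : V → Submodule ℝ V, KCone.IsExpSeparation k C Φ (KCone.omegaSet Φ x) E F) ∧
    ∀ E F : V → Submodule ℝ V, KCone.IsExpSeparation k C Φ (KCone.omegaSet Φ x) E F →
      ∀ z ∈ KCone.omegaSet Φ x, KCone.IsRegularPoint Φ E z → KCone.lyapunovExponent Φ E z ≤ 0 →
        x ∈ KCone.pseudoOrderedSet C Φ ∨
          (KCone.omegaSet Φ x = {z} ∧ KCone.IsEquilibrium Φ z) :=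
  (theorem4p2_general k C Φ hΦ x hx).imp_right fun h E F hs z hz _ => h E F hs z hz
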